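/- Let $X_1,\dots,X_n$ ($n\ge 1$) be independent non-negative random variables with known continuous (atomless) distributions and let $Z=\max(X_1,\dots,X_n)$. In \textsc{Semi-Online-Load-Minimization} the realized values are hidden. A (possibly randomized) gambler adaptively asks queries of the form "is $X_i\ge\tau$?", where $i$ and $\tau\in\mathbb{R}$ are of the gambler's choice and a variable may be queried several times, but at most $n$ queries may be asked in total. When the gambler stops, the gambler selects a variable whose conditional expectation given all the answers is highest and receives its value $\mathrm{ALG}$. The load is the maximum, over $i$, of the number of queries asked about $X_i$. Let $\log^* n$ be the smallest integer $t\ge 0$ such that the $t$-fold iterated natural logarithm of $n$ is at most $1$. There are an algorithm for this problem and universal constants $C,c>0$ such that for every $n\ge1$ and all such $X_1,\dots,X_n$ (identically distributed or not) the algorithm asks at most $n$ queries in every run, the expectation of its load is at most $C\log^* n$, and $$\mathbb{E}[\mathrm{ALG}]\ \ge\ \left(1-C\,n^{-c}\right)\,\mathbb{E}[Z].$$ In particular it is $(1-o(1))$-competitive with $O(\log^* n)$ expected load, uniformly over the distributions. -/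

import Mathlib

open MeasureTheory ProbabilityTheory
open scoped ENNReal

/-- The iterated logarithm `log* x`: the smallest `t` with `log (log (⋯ (log x))) ≤ 1`
(`t` nested natural logarithms). -/
noncomputable def logStar (x : ℝ) : ℕ := sInf {t : ℕ | Real.log^[t] x ≤ 1}

/-- A deterministic adaptive strategy of the gambler on `n` variables: a finite decision tree.
`query i τ yes no` asks "is `X i ≥ τ`?" and continues with `yes` or `no` according to the answer;
`select i` ends the game with the variable `X i`. -/
inductive QueryTree (n : ℕ) : Type
  | select (i : Fin n) : QueryTree n
  | query (i : Fin n) (τ : ℝ) (yes no : QueryTree n) : QueryTree n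

namespace QueryTree

variable {n : ℕ}

/-- The variable that is selected when the hidden values are `x`. -/
noncomputable def choice : QueryTree n → (Fin n → ℝ) → Fin n
  | select i, _ => i
  | query i τ yes no, x => if τ ≤ x i then yes.choice x else no.choice x

/-- The number of times that variable `j` is queried when the hidden values are `x`. -/
noncomputable def queriesTo : QueryTree n → (Fin n → ℝ) → Fin n → ℕ
  | select _, _, _ => 0
  | query i τ yes no, x, j =>
      (if i = j then 1 else 0) + if τ ≤ x i then yes.queriesTo x j else no.queriesTo x j

/-- The total number of queries that are asked when the hidden values are `x`. -/
noncomputable def numQueries (T : QueryTree n) (x : Fin n → ℝ) : ℕ := ∑ j, T.queriesTo x j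

/-- The load when the hidden values are `x`: the largest number of queries to a single variable. -/
noncomputable def load (T : QueryTree n) (x : Fin n → ℝ) : ℕ := Finset.univ.sup (T.queriesTo x)

/-- The information that the gambler has at the end when the hidden values are `x`: the event
consisting of all vectors of values that are consistent with all the answers received. -/
def observed : QueryTree n → (Fin n → ℝ) → Set (Fin n → ℝ)
  | select _, _ => Set.univ
  | query i τ yes no, x =>
      {y | (τ ≤ y i ↔ τ ≤ x i) ∧ (τ ≤ x i → y ∈ yes.observed x) ∧ (¬ τ ≤ x i → y ∈ no.observed x)}

/-- At the end the gambler selects a variable whose conditional expectation, given all the answers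
received, is highest. Here `P` is the joint law of the (nonnegative) variables. -/
def SelectsBest (T : QueryTree n) (P : Measure (Fin n → ℝ)) : Prop :=
  ∀ (x : Fin n → ℝ) (j : Fin n),
    ∫⁻ y, ENNReal.ofReal (y j) ∂(ProbabilityTheory.cond P (T.observed x)) ≤
      ∫⁻ y, ENNReal.ofReal (y (T.choice x)) ∂(ProbabilityTheory.cond P (T.observed x))

end QueryTree

/-- A randomized strategy: a probability distribution on deterministic strategies, which is drawn
from independently of the hidden values. -/
abbrev RandomizedStrategy (n : ℕ) : Type := PMF (QueryTree n)

namespace RandomizedStrategy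

variable {n : ℕ}

/-- The expected reward `E[ALG]`, the reward being the value of the selected variable; the
expectation is over the strategy's randomness and the values `x`, of law `P`. -/
noncomputable def expectedReward (A : RandomizedStrategy n) (P : Measure (Fin n → ℝ)) : ℝ≥0∞ :=
  ∑' T : QueryTree n, A T * ∫⁻ x, ENNReal.ofReal (x (T.choice x)) ∂P

/-- The expected load, over the strategy's randomness and the values `x`, of law `P`. -/
noncomputable def expectedLoad (A : RandomizedStrategy n) (P : Measure (Fin n → ℝ)) : ℝ≥0∞ :=
  ∑' T : QueryTree n, A T * ∫⁻ x, (T.load x : ℝ≥0∞) ∂P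

/-- `A` respects the rules for variables with joint law `P`: however the randomness falls, at most
`n` queries are asked in total, whatever the hidden values are, and at the end a variable of highest
conditional expectation is selected. -/
def IsAdmissible (A : RandomizedStrategy n) (P : Measure (Fin n → ℝ)) : Prop :=
  ∀ T ∈ PMF.support A, (∀ x, T.numQueries x ≤ n) ∧ T.SelectsBest P

end RandomizedStrategy

/-- The prophet's expected value `E[Z]`, `Z = max (X 1, …, X n)`. -/
noncomputable def prophetValue {n : ℕ} (P : Measure (Fin n → ℝ)) : ℝ≥0∞ :=
  ∫⁻ x, ENNReal.ofReal (⨆ i, x i) ∂P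

/-! The load can be kept bounded in expectation; `log*` enters only through `one_le_logStar`.
Everything rests on one consequence of independence (`IsProductLaw.mul_setLIntegral_le`): if no
member of `S` reaches `τ` with probability `δ`, then each member that reaches `τ` is the only one to
do so with conditional probability at least `δ`, whatever its own value. The inequality also holds
with a function of that value as weight.

With `τ` the median of the maximum, a round therefore isolates a single survivor on at least a
quarter of the mass, measured either by probability or by the expected maximum. A unique survivor is
the maximum. Otherwise the search continues among the remaining candidates, still independent under
the restricted law. Hence at most four rounds are expected, and `r` rounds lose a fraction at most
`(3/4) ^ r` of the expected maximum (`lintegral_load_search_le`, `lintegral_maxOver_le_search`).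

Repeated rounds on all variables would exceed the query budget. Take `q` about `n ^ (1/4)`. One
sweep at the `1/q` quantile leaves between one and `q ^ 2` survivors, up to a loss of `4/q`, and `q`
rounds of median search on them cost at most `q ^ 3` queries. These are paid for by never querying
`q ^ 3` variables, chosen by averaging at a loss of `1/q` (`exists_cheap_to_drop`). Replacing each
selection by one of highest conditional expectation can only raise the reward. -/

namespace QueryTree

variable {n : ℕ}

/-! ### Querying a list of variables against a common threshold -/

/-- Query the variables of a list against the threshold `τ`, add those that reach it to `acc`,
and continue with the strategy that `k` assigns to the result. -/
def scanList (τ : ℝ) (k : Finset (Fin n) → QueryTree n) :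
    List (Fin n) → Finset (Fin n) → QueryTree n
  | [], acc => k acc
  | i :: l, acc => query i τ (scanList τ k l (insert i acc)) (scanList τ k l acc)

/-- The members of `S` whose value is at least `τ`. -/
noncomputable def survivors (S : Finset (Fin n)) (τ : ℝ) (x : Fin n → ℝ) : Finset (Fin n) :=
  S.filter fun i => τ ≤ x i

/-- Query every member of `S` against `τ` and continue with `k` applied to the survivors. -/
noncomputable def scan (S : Finset (Fin n)) (τ : ℝ) (k : Finset (Fin n) → QueryTree n) :
    QueryTree n :=
  scanList τ k S.toList ∅

theorem choice_scanList (τ : ℝ) (k : Finset (Fin n) → QueryTree n) (x : Fin n → ℝ)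
    (l : List (Fin n)) (acc : Finset (Fin n)) :
    (scanList τ k l acc).choice x = (k (acc ∪ l.toFinset.filter fun i => τ ≤ x i)).choice x := by
  induction l generalizing acc with
  | nil => simp [scanList]
  | cons i l ih =>
    by_cases h : τ ≤ x i <;> simp [scanList, choice, ih, h, Finset.filter_insert]

theorem queriesTo_scanList (τ : ℝ) (k : Finset (Fin n) → QueryTree n) (x : Fin n → ℝ)
    (j : Fin n) (l : List (Fin n)) (acc : Finset (Fin n)) :
    (scanList τ k l acc).queriesTo x j =
      l.count j + (k (acc ∪ l.toFinset.filter fun i => τ ≤ x i)).queriesTo x j := by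
  induction l generalizing acc with
  | nil => simp [scanList]
  | cons i l ih =>
    by_cases h : τ ≤ x i <;>
      simp [scanList, queriesTo, ih, h, Finset.filter_insert, List.count_cons] <;> ring

theorem choice_scan (S : Finset (Fin n)) (τ : ℝ) (k : Finset (Fin n) → QueryTree n)
    (x : Fin n → ℝ) : (scan S τ k).choice x = (k (survivors S τ x)).choice x := by
  simp [scan, choice_scanList, survivors]

theorem queriesTo_scan (S : Finset (Fin n)) (τ : ℝ) (k : Finset (Fin n) → QueryTree n)
    (x : Fin n → ℝ) (j : Fin n) :
    (scan S τ k).queriesTo x j =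
      (if j ∈ S then 1 else 0) + (k (survivors S τ x)).queriesTo x j := by
  simp [scan, queriesTo_scanList, survivors, S.nodup_toList.count]

theorem numQueries_scan (S : Finset (Fin n)) (τ : ℝ) (k : Finset (Fin n) → QueryTree n)
    (x : Fin n → ℝ) :
    (scan S τ k).numQueries x = S.card + (k (survivors S τ x)).numQueries x := by
  simp [numQueries, queriesTo_scan, Finset.sum_add_distrib]

theorem load_scan_le (S : Finset (Fin n)) (τ : ℝ) (k : Finset (Fin n) → QueryTree n)
    (x : Fin n → ℝ) : (scan S τ k).load x ≤ 1 + (k (survivors S τ x)).load x := by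
  refine Finset.sup_le fun j _ => ?_
  rw [queriesTo_scan]
  have : (k (survivors S τ x)).queriesTo x j ≤ (k (survivors S τ x)).load x :=
    Finset.le_sup (f := (k (survivors S τ x)).queriesTo x) (Finset.mem_univ j)
  split_ifs <;> omega

@[simp] theorem load_select (i : Fin n) (x : Fin n → ℝ) : (select i).load x = 0 := by
  simp [load, queriesTo]

@[simp] theorem numQueries_select (i : Fin n) (x : Fin n → ℝ) :
    (select i).numQueries x = 0 := by
  simp [numQueries, queriesTo]

/-! ### Selecting optimally at the leaves -/

/-- Integrals over `E` suffice: conditioning on `E` scales all of them by the same factor. -/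
theorem exists_best [NeZero n] (P : Measure (Fin n → ℝ)) (E : Set (Fin n → ℝ)) :
    ∃ i, ∀ j, ∫⁻ y in E, ENNReal.ofReal (y j) ∂P ≤ ∫⁻ y in E, ENNReal.ofReal (y i) ∂P :=
  Finite.exists_max fun i => ∫⁻ y in E, ENNReal.ofReal (y i) ∂P

/-- Replace every selection of the tree by that of a variable of highest conditional expectation,
where `E` is the event known at the root. -/
noncomputable def optimize [NeZero n] (P : Measure (Fin n → ℝ)) :
    QueryTree n → Set (Fin n → ℝ) → QueryTree n
  | select _, E => select (exists_best P E).choose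
  | query i τ yes no, E =>
      query i τ (yes.optimize P (E ∩ {y | τ ≤ y i})) (no.optimize P (E ∩ {y | τ ≤ y i}ᶜ))

theorem queriesTo_optimize [NeZero n] (P : Measure (Fin n → ℝ)) (T : QueryTree n)
    (E : Set (Fin n → ℝ)) (x : Fin n → ℝ) (j : Fin n) :
    (T.optimize P E).queriesTo x j = T.queriesTo x j := by
  induction T generalizing E with
  | select i => rfl
  | query i τ yes no ih₁ ih₂ => simp [optimize, queriesTo, ih₁, ih₂]

theorem numQueries_optimize [NeZero n] (P : Measure (Fin n → ℝ)) (T : QueryTree n)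
    (E : Set (Fin n → ℝ)) (x : Fin n → ℝ) :
    (T.optimize P E).numQueries x = T.numQueries x := by
  simp [numQueries, queriesTo_optimize]

theorem load_optimize [NeZero n] (P : Measure (Fin n → ℝ)) (T : QueryTree n)
    (E : Set (Fin n → ℝ)) (x : Fin n → ℝ) : (T.optimize P E).load x = T.load x := by
  simp only [load]
  congr 1
  funext j
  exact queriesTo_optimize P T E x j

/-- The set passed down the branch followed by `x` accumulates the answers, so at the leaf it is
exactly `E` intersected with the observed event. -/
theorem lintegral_le_choice_optimize [NeZero n] (P : Measure (Fin n → ℝ)) (T : QueryTree n)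
    (E : Set (Fin n → ℝ)) (x : Fin n → ℝ) (j : Fin n) :
    ∫⁻ y in E ∩ (T.optimize P E).observed x, ENNReal.ofReal (y j) ∂P ≤
      ∫⁻ y in E ∩ (T.optimize P E).observed x,
        ENNReal.ofReal (y ((T.optimize P E).choice x)) ∂P := by
  induction T generalizing E with
  | select i =>
    simpa [optimize, observed, choice] using (exists_best P E).choose_spec j
  | query i τ yes no ih₁ ih₂ =>
    by_cases h : τ ≤ x i
    · have hE : E ∩ ((query i τ yes no).optimize P E).observed x =
          E ∩ {y | τ ≤ y i} ∩ (yes.optimize P (E ∩ {y | τ ≤ y i})).observed x := by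
        ext y
        simp [optimize, observed, h, and_assoc]
      have hc : ((query i τ yes no).optimize P E).choice x =
          (yes.optimize P (E ∩ {y | τ ≤ y i})).choice x := by simp [optimize, choice, h]
      rw [hE, hc]
      exact ih₁ _
    · have hE : E ∩ ((query i τ yes no).optimize P E).observed x =
          E ∩ {y | τ ≤ y i}ᶜ ∩ (no.optimize P (E ∩ {y | τ ≤ y i}ᶜ)).observed x := by
        ext y
        simp only [optimize, observed, h, Set.mem_inter_iff, Set.mem_ofPred_eq, Set.mem_compl_iff,
          iff_false, false_imp_iff, true_and, not_false_eq_true, true_imp_iff, and_assoc]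
      have hc : ((query i τ yes no).optimize P E).choice x =
          (no.optimize P (E ∩ {y | τ ≤ y i}ᶜ)).choice x := by simp only [optimize, choice, h, if_false]
      rw [hE, hc]
      exact ih₂ _

theorem selectsBest_optimize [NeZero n] (P : Measure (Fin n → ℝ)) [IsFiniteMeasure P]
    (T : QueryTree n) : (T.optimize P Set.univ).SelectsBest P := by
  intro x j
  simp only [ProbabilityTheory.cond, lintegral_smul_measure, smul_eq_mul]
  refine mul_le_mul' le_rfl ?_
  simpa using lintegral_le_choice_optimize P T Set.univ x j

theorem setLIntegral_split {α : Type*} [MeasurableSpace α] (P : Measure α) (E B : Set α)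
    (hB : MeasurableSet B) (f : α → ℝ≥0∞) :
    ∫⁻ x in E, f x ∂P = ∫⁻ x in E ∩ B, f x ∂P + ∫⁻ x in E ∩ Bᶜ, f x ∂P := by
  rw [← Set.sdiff_eq, lintegral_inter_add_sdiff f E hB]

theorem lintegral_choice_query (P : Measure (Fin n → ℝ)) (i : Fin n) (τ : ℝ)
    (yes no : QueryTree n) (E : Set (Fin n → ℝ)) (hE : MeasurableSet E) :
    ∫⁻ x in E, ENNReal.ofReal (x ((query i τ yes no).choice x)) ∂P =
      ∫⁻ x in E ∩ {y | τ ≤ y i}, ENNReal.ofReal (x (yes.choice x)) ∂P +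
      ∫⁻ x in E ∩ {y | τ ≤ y i}ᶜ, ENNReal.ofReal (x (no.choice x)) ∂P := by
  have hB : MeasurableSet {y : Fin n → ℝ | τ ≤ y i} :=
    measurableSet_le measurable_const (measurable_pi_apply i)
  rw [setLIntegral_split P E _ hB]
  congr 1
  · refine setLIntegral_congr_fun (hE.inter hB) fun x hx => ?_
    have : τ ≤ x i := hx.2
    simp [choice, this]
  · refine setLIntegral_congr_fun (hE.inter hB.compl) fun x hx => ?_
    have : ¬ τ ≤ x i := hx.2
    simp only [choice, this, if_false]

theorem lintegral_choice_le_optimize [NeZero n] (P : Measure (Fin n → ℝ)) (T : QueryTree n)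
    (E : Set (Fin n → ℝ)) (hE : MeasurableSet E) :
    ∫⁻ x in E, ENNReal.ofReal (x (T.choice x)) ∂P ≤
      ∫⁻ x in E, ENNReal.ofReal (x ((T.optimize P E).choice x)) ∂P := by
  induction T generalizing E with
  | select i => simpa [optimize, choice] using (exists_best P E).choose_spec i
  | query i τ yes no ih₁ ih₂ =>
    have hB : MeasurableSet {y : Fin n → ℝ | τ ≤ y i} :=
      measurableSet_le measurable_const (measurable_pi_apply i)
    rw [optimize, lintegral_choice_query P i τ _ _ E hE, lintegral_choice_query P i τ _ _ E hE]
    exact add_le_add (ih₁ _ (hE.inter hB)) (ih₂ _ (hE.inter hB.compl))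

/-- Always selecting `j` is available at every leaf. This settles the case of an infinite prophet
value. -/
theorem lintegral_le_optimize [NeZero n] (P : Measure (Fin n → ℝ)) (T : QueryTree n)
    (E : Set (Fin n → ℝ)) (hE : MeasurableSet E) (j : Fin n) :
    ∫⁻ x in E, ENNReal.ofReal (x j) ∂P ≤
      ∫⁻ x in E, ENNReal.ofReal (x ((T.optimize P E).choice x)) ∂P := by
  induction T generalizing E with
  | select i => simpa [optimize, choice] using (exists_best P E).choose_spec j
  | query i τ yes no ih₁ ih₂ =>
    have hB : MeasurableSet {y : Fin n → ℝ | τ ≤ y i} :=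
      measurableSet_le measurable_const (measurable_pi_apply i)
    rw [optimize, lintegral_choice_query P i τ _ _ E hE, setLIntegral_split P E _ hB]
    exact add_le_add (ih₁ _ (hE.inter hB)) (ih₂ _ (hE.inter hB.compl))

end QueryTree

/-! ### Product laws and the partition by the set of survivors -/

/-- An unnormalized joint law of independent real variables without atoms. -/
def IsProductLaw {n : ℕ} (P : Measure (Fin n → ℝ)) : Prop :=
  ∃ ν : Fin n → Measure ℝ, (∀ i, IsFiniteMeasure (ν i)) ∧ (∀ i a, ν i {a} = 0) ∧ P = Measure.pi ν

/-- The event that `S'` is the set of members of `S` that reach the threshold `τ`. -/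
def survivorEvent {n : ℕ} (S : Finset (Fin n)) (τ : ℝ) (S' : Finset (Fin n)) :
    Set (Fin n → ℝ) :=
  {x | QueryTree.survivors S τ x = S'}

section survivorEvent

variable {n : ℕ} {S S' : Finset (Fin n)} {τ : ℝ} {x : Fin n → ℝ}

theorem mem_survivorEvent_iff (h : S' ⊆ S) :
    x ∈ survivorEvent S τ S' ↔ ∀ i, (i ∈ S' → τ ≤ x i) ∧ (i ∈ S → i ∉ S' → x i < τ) := by
  simp only [survivorEvent, QueryTree.survivors, Set.mem_ofPred_eq, Finset.ext_iff,
    Finset.mem_filter]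
  refine forall_congr' fun i => ?_
  have := @h i
  rw [← not_le]
  tauto

theorem mem_survivorEvent_empty : x ∈ survivorEvent S τ ∅ ↔ ∀ i ∈ S, x i < τ := by
  simp [mem_survivorEvent_iff (Finset.empty_subset S)]

theorem mem_survivorEvent_singleton {i : Fin n} (hi : i ∈ S) :
    x ∈ survivorEvent S τ {i} ↔ τ ≤ x i ∧ ∀ j ∈ S.erase i, x j < τ := by
  rw [mem_survivorEvent_iff (by simpa using hi)]
  simp only [Finset.mem_singleton, Finset.mem_erase]
  constructor
  · intro h
    exact ⟨(h i).1 rfl, fun j hj => (h j).2 hj.2 hj.1⟩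
  · rintro ⟨h1, h2⟩ j
    exact ⟨fun hj => hj ▸ h1, fun hj hji => h2 j ⟨hji, hj⟩⟩

theorem measurableSet_survivorEvent (S : Finset (Fin n)) (τ : ℝ) (S' : Finset (Fin n)) :
    MeasurableSet (survivorEvent S τ S') := by
  by_cases h : S' ⊆ S
  · have : survivorEvent S τ S' =
        ⋂ i, ({x | i ∈ S' → τ ≤ x i} ∩ {x | i ∈ S → i ∉ S' → x i < τ}) := by
      ext x
      simp [mem_survivorEvent_iff h]
    rw [this]
    refine MeasurableSet.iInter fun i => MeasurableSet.inter ?_ ?_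
    · by_cases hi : i ∈ S' <;> simp only [hi, true_imp_iff, false_imp_iff]
      · exact measurableSet_le measurable_const (measurable_pi_apply i)
      · exact MeasurableSet.univ
    · by_cases hi : i ∈ S <;> by_cases hi' : i ∈ S' <;>
        simp only [hi, hi', not_true, not_false_eq_true, true_imp_iff, false_imp_iff]
      · exact MeasurableSet.univ
      · exact measurableSet_lt (measurable_pi_apply i) measurable_const
      · exact MeasurableSet.univ
      · exact MeasurableSet.univ
  · have : survivorEvent S τ S' = ∅ := by
      ext x
      simp only [survivorEvent, Set.mem_ofPred_eq, Set.mem_empty_iff_false, iff_false]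
      rintro rfl
      exact h (Finset.filter_subset _ _)
    rw [this]
    exact MeasurableSet.empty

theorem pairwise_disjoint_survivorEvent (S : Finset (Fin n)) (τ : ℝ) :
    Pairwise (Function.onFun Disjoint (survivorEvent S τ)) := by
  intro A B hAB
  rw [Function.onFun, Set.disjoint_left]
  intro x hA hB
  exact hAB (hA.symm.trans hB)

theorem biUnion_survivorEvent (S : Finset (Fin n)) (τ : ℝ) :
    ⋃ S' ∈ S.powerset, survivorEvent S τ S' = Set.univ := by
  ext x
  simp only [Set.mem_iUnion, Set.mem_univ, iff_true]
  exact ⟨QueryTree.survivors S τ x, Finset.mem_powerset.2 (Finset.filter_subset _ _), rfl⟩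

theorem lintegral_eq_sum_survivorEvent (P : Measure (Fin n → ℝ)) (S : Finset (Fin n)) (τ : ℝ)
    (f : (Fin n → ℝ) → ℝ≥0∞) :
    ∫⁻ x, f x ∂P = ∑ S' ∈ S.powerset, ∫⁻ x in survivorEvent S τ S', f x ∂P := by
  rw [← lintegral_biUnion_finset ((pairwise_disjoint_survivorEvent S τ).set_pairwise _)
    (fun S' _ => measurableSet_survivorEvent S τ S'), biUnion_survivorEvent, setLIntegral_univ]

end survivorEvent

/-! ### Independence and quantiles of a maximum -/

namespace IsProductLaw

variable {n : ℕ} {P : Measure (Fin n → ℝ)}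

theorem isFiniteMeasure (hP : IsProductLaw P) : IsFiniteMeasure P := by
  obtain ⟨ν, hν, -, rfl⟩ := hP
  infer_instance

theorem measure_eq_zero (hP : IsProductLaw P) (i : Fin n) (a : ℝ) : P {x | x i = a} = 0 := by
  obtain ⟨ν, hν, hν', rfl⟩ := hP
  have : {x : Fin n → ℝ | x i = a} = Function.eval i ⁻¹' ({a} : Set ℝ) := rfl
  rw [this]
  exact Measure.pi_eval_preimage_null ν (hν' i a)

/-- The event is a box, so restriction preserves the product form. This is what permits recursion;
working with unnormalized measures avoids dividing by probabilities that may vanish. -/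
theorem restrict_survivorEvent (hP : IsProductLaw P) {S S' : Finset (Fin n)} (h : S' ⊆ S)
    (τ : ℝ) : IsProductLaw (P.restrict (survivorEvent S τ S')) := by
  obtain ⟨ν, hν, hν', rfl⟩ := hP
  let A : Fin n → Set ℝ := fun i => {t | (i ∈ S' → τ ≤ t) ∧ (i ∈ S → i ∉ S' → t < τ)}
  have hA : survivorEvent S τ S' = Set.univ.pi A := by
    ext x
    simp [mem_survivorEvent_iff h, A, Set.mem_pi]
  refine ⟨fun i => (ν i).restrict (A i), fun i => inferInstance, fun i a => ?_, ?_⟩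
  · exact le_antisymm ((Measure.restrict_apply_le _ _).trans_eq (hν' i a)) bot_le
  · rw [hA, Measure.restrict_pi_pi]

/-- A function of one coordinate is independent of a function of the others. -/
theorem lintegral_mul (hP : IsProductLaw P) (i : Fin n) {f : ℝ → ℝ≥0∞} (hf : Measurable f)
    {F : (Fin n → ℝ) → ℝ≥0∞} (hF : Measurable F) (hFi : ∀ x t, F (Function.update x i t) = F x) :
    P Set.univ * ∫⁻ x, f (x i) * F x ∂P = (∫⁻ x, f (x i) ∂P) * ∫⁻ x, F x ∂P := by
  obtain ⟨ν, hν, -, rfl⟩ := hP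
  -- Integrating out coordinate `i` first factors the integral. Four instances, with either function
  -- replaced by 1, give the unnormalized product formula.
  have key : ∀ (g : ℝ → ℝ≥0∞) (G : (Fin n → ℝ) → ℝ≥0∞), Measurable g → Measurable G →
      (∀ x t, G (Function.update x i t) = G x) →
      ∫⁻ x, g (x i) * G x ∂Measure.pi ν =
        (∫⁻ t, g t ∂ν i) * (∫⋯∫⁻_Finset.univ.erase i, G ∂ν) 0 := by
    intro g G hg hG hGi
    have hm : Measurable fun x : Fin n → ℝ => g (x i) * G x :=
      (hg.comp (measurable_pi_apply i)).mul hG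
    rw [lintegral_eq_lmarginal_univ 0, lmarginal_erase' _ hm (Finset.mem_univ i)]
    simp only [Function.update_self, hGi]
    simp_rw [lintegral_mul_const _ hg]
    rw [lmarginal, lintegral_const_mul, lmarginal]
    exact hG.comp measurable_updateFinset
  have h1 := key f F hf hF hFi
  have h2 := key 1 F measurable_one hF hFi
  have h3 := key f 1 hf measurable_one (fun _ _ => rfl)
  have h4 := key 1 1 measurable_one measurable_one (fun _ _ => rfl)
  simp only [Pi.one_apply, one_mul, mul_one, lintegral_one] at h1 h2 h3 h4
  rw [h1, h2, h3, h4]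
  ring

/-- Without atoms, almost every `x` has no coordinate equal to `τ`, so its membership in the event
is constant for thresholds near `τ`; dominated convergence applies. -/
theorem continuous_measure_lt (hP : IsProductLaw P) (S : Finset (Fin n)) :
    Continuous fun τ => P (survivorEvent S τ ∅) := by
  have := hP.isFiniteMeasure
  rw [continuous_iff_continuousAt]
  intro τ
  refine tendsto_measure_of_ae_tendsto_indicator_of_isFiniteMeasure (L := nhds τ)
    (measurableSet_survivorEvent S τ ∅) (fun t => measurableSet_survivorEvent S t ∅) ?_
  have h : ∀ᵐ x ∂P, ∀ i, x i ≠ τ := ae_all_iff.2 fun i => by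
    simpa [ae_iff] using hP.measure_eq_zero i τ
  filter_upwards [h] with x hx
  have : ∀ i, ∀ᶠ t in nhds τ, (x i < t ↔ x i < τ) := fun i => by
    rcases lt_or_gt_of_ne (hx i) with h | h
    · filter_upwards [lt_mem_nhds h] with t ht
      exact iff_of_true ht h
    · filter_upwards [gt_mem_nhds h] with t ht
      exact iff_of_false ht.not_gt h.not_gt
  filter_upwards [Filter.eventually_all.2 this] with t ht
  simp only [mem_survivorEvent_empty, ht]

theorem tendsto_measure_lt_atTop (hP : IsProductLaw P) (S : Finset (Fin n)) :
    Filter.Tendsto (fun τ => P (survivorEvent S τ ∅)) Filter.atTop (nhds (P Set.univ)) := by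
  have := hP.isFiniteMeasure
  refine tendsto_measure_of_ae_tendsto_indicator_of_isFiniteMeasure (L := Filter.atTop)
    MeasurableSet.univ (fun t => measurableSet_survivorEvent S t ∅) ?_
  refine .of_forall fun x => ?_
  filter_upwards [Filter.eventually_all.2 fun i => Filter.eventually_gt_atTop (x i)] with t ht
  simp [mem_survivorEvent_empty, ht]

theorem tendsto_measure_lt_atBot (hP : IsProductLaw P) {S : Finset (Fin n)} (hS : S.Nonempty) :
    Filter.Tendsto (fun τ => P (survivorEvent S τ ∅)) Filter.atBot (nhds 0) := by
  have := hP.isFiniteMeasure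
  rw [← measure_empty (μ := P)]
  refine tendsto_measure_of_ae_tendsto_indicator_of_isFiniteMeasure (L := Filter.atBot)
    MeasurableSet.empty (fun t => measurableSet_survivorEvent S t ∅) ?_
  refine .of_forall fun x => ?_
  obtain ⟨i, hi⟩ := hS
  filter_upwards [Filter.eventually_lt_atBot (x i)] with t ht
  simp only [mem_survivorEvent_empty, Set.mem_empty_iff_false, iff_false]
  exact fun h => (h i hi).not_gt ht

/-- Every quantile of the maximum of a nonempty set of variables is attained. -/
theorem exists_quantile (hP : IsProductLaw P) {S : Finset (Fin n)} (hS : S.Nonempty)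
    {δ : ℝ≥0∞} (h0 : δ ≠ 0) (h1 : δ < 1) : ∃ τ, P (survivorEvent S τ ∅) = δ * P Set.univ := by
  have := hP.isFiniteMeasure
  rcases eq_or_ne (P Set.univ) 0 with h | h
  · refine ⟨0, ?_⟩
    rw [h, mul_zero]
    exact measure_mono_null (Set.subset_univ _) h
  have hlt : δ * P Set.univ < P Set.univ := by
    simpa using ENNReal.mul_lt_mul_left h (measure_ne_top P _) h1
  have hpos : 0 < δ * P Set.univ := pos_iff_ne_zero.2 (mul_ne_zero h0 h)
  obtain ⟨a, ha⟩ := ((hP.tendsto_measure_lt_atBot hS).eventually_lt_const hpos).exists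
  obtain ⟨b, hb⟩ := ((hP.tendsto_measure_lt_atTop S).eventually_const_lt hlt).exists
  exact mem_range_of_exists_le_of_exists_ge (hP.continuous_measure_lt S) ⟨a, ha.le⟩ ⟨b, hb.le⟩

/-- A survivor is the only one with probability at least that of there being no survivor. -/
theorem mul_setLIntegral_le (hP : IsProductLaw P) {S : Finset (Fin n)} {τ : ℝ} {δ : ℝ≥0∞}
    (hδ : P (survivorEvent S τ ∅) = δ * P Set.univ) {i : Fin n} (hi : i ∈ S)
    {g : ℝ → ℝ≥0∞} (hg : Measurable g) :
    δ * ∫⁻ x in {x | τ ≤ x i}, g (x i) ∂P ≤ ∫⁻ x in survivorEvent S τ {i}, g (x i) ∂P := by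
  have := hP.isFiniteMeasure
  rcases eq_or_ne (P Set.univ) 0 with h | h
  · rw [Measure.measure_univ_eq_zero] at h
    simp [h]
  have hm1 : MeasurableSet {x : Fin n → ℝ | τ ≤ x i} :=
    measurableSet_le measurable_const (measurable_pi_apply i)
  have hm2 := measurableSet_survivorEvent (S.erase i) τ ∅
  have hE : survivorEvent S τ {i} = {x | τ ≤ x i} ∩ survivorEvent (S.erase i) τ ∅ := by
    ext x
    rw [mem_survivorEvent_singleton hi, Set.mem_inter_iff, mem_survivorEvent_empty]
    rfl
  have hind := hP.lintegral_mul i (f := (Set.Ici τ).indicator g) (hg.indicator measurableSet_Ici)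
    (F := (survivorEvent (S.erase i) τ ∅).indicator 1) (measurable_one.indicator hm2) (by
      intro x t
      simp only [Set.indicator, mem_survivorEvent_empty]
      congr 1
      refine propext (forall₂_congr fun j hj => ?_)
      rw [Function.update_of_ne (Finset.ne_of_mem_erase hj)])
  have e1 : ∫⁻ x, (Set.Ici τ).indicator g (x i) ∂P = ∫⁻ x in {x | τ ≤ x i}, g (x i) ∂P := by
    rw [← lintegral_indicator hm1]
    rfl
  have e2 : ∫⁻ x, (Set.Ici τ).indicator g (x i) *
      (survivorEvent (S.erase i) τ ∅).indicator 1 x ∂P =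
      ∫⁻ x in survivorEvent S τ {i}, g (x i) ∂P := by
    rw [← lintegral_indicator (measurableSet_survivorEvent _ _ _), hE]
    refine lintegral_congr fun x => ?_
    by_cases h1 : τ ≤ x i <;> by_cases h2 : x ∈ survivorEvent (S.erase i) τ ∅ <;>
      simp [Set.indicator, h1, h2]
  rw [e1, e2, lintegral_indicator_one hm2] at hind
  -- That the others stay below `τ` is independent of `x i` and at least as likely as that all do.
  have hle : δ * P Set.univ ≤ P (survivorEvent (S.erase i) τ ∅) := by
    rw [← hδ]
    refine measure_mono fun x hx => ?_
    rw [mem_survivorEvent_empty] at hx ⊢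
    exact fun j hj => hx j (Finset.mem_of_mem_erase hj)
  refine (ENNReal.mul_le_mul_iff_right h (measure_ne_top P _)).1 ?_
  rw [hind]
  calc P Set.univ * (δ * ∫⁻ x in {x | τ ≤ x i}, g (x i) ∂P)
      = (∫⁻ x in {x | τ ≤ x i}, g (x i) ∂P) * (δ * P Set.univ) := by ring
    _ ≤ _ := by gcongr

end IsProductLaw

/-! ### The maximum over a set of variables -/

/-- The largest of the values of the members of `S`. -/
noncomputable def maxOver {n : ℕ} (S : Finset (Fin n)) (x : Fin n → ℝ) : ℝ≥0∞ :=
  S.sup fun i => ENNReal.ofReal (x i)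

section maxOver

variable {n : ℕ} {S S' : Finset (Fin n)} {τ : ℝ} {x : Fin n → ℝ}

theorem measurable_maxOver (S : Finset (Fin n)) : Measurable (maxOver S) := by
  unfold maxOver
  simp_rw [Finset.sup_eq_iSup]
  exact Measurable.iSup fun i => Measurable.iSup fun _ => (measurable_pi_apply i).ennreal_ofReal

theorem le_maxOver {i : Fin n} (hi : i ∈ S) (x : Fin n → ℝ) :
    ENNReal.ofReal (x i) ≤ maxOver S x :=
  Finset.le_sup (f := fun i => ENNReal.ofReal (x i)) hi

theorem maxOver_mono (h : S' ⊆ S) (x : Fin n → ℝ) : maxOver S' x ≤ maxOver S x :=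
  Finset.sup_mono h

theorem maxOver_eq_of_mem_survivorEvent (h : S' ⊆ S) (h' : S'.Nonempty)
    (hx : x ∈ survivorEvent S τ S') : maxOver S x = maxOver S' x := by
  refine le_antisymm (Finset.sup_le fun i hi => ?_) (maxOver_mono h x)
  rw [mem_survivorEvent_iff h] at hx
  by_cases hi' : i ∈ S'
  · exact le_maxOver hi' x
  · obtain ⟨j, hj⟩ := h'
    exact (ENNReal.ofReal_le_ofReal (((hx i).2 hi hi').le.trans ((hx j).1 hj))).trans
      (le_maxOver hj x)

theorem maxOver_singleton (i : Fin n) (x : Fin n → ℝ) :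
    maxOver {i} x = ENNReal.ofReal (x i) := by
  simp [maxOver]

theorem exists_le_of_notMem_survivorEvent_empty (hx : x ∉ survivorEvent S τ ∅) :
    ∃ i ∈ S, τ ≤ x i := by
  simpa [mem_survivorEvent_empty] using hx

theorem exists_maxOver_eq_of_notMem_survivorEvent_empty (hx : x ∉ survivorEvent S τ ∅) :
    ∃ i ∈ S, τ ≤ x i ∧ maxOver S x = ENNReal.ofReal (x i) := by
  obtain ⟨j, hj, hjx⟩ := exists_le_of_notMem_survivorEvent_empty hx
  obtain ⟨i, hi, him⟩ := S.exists_max_image x ⟨j, hj⟩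
  refine ⟨i, hi, hjx.trans (him j hj), le_antisymm (Finset.sup_le fun k hk => ?_) (le_maxOver hi x)⟩
  exact ENNReal.ofReal_le_ofReal (him k hk)

end maxOver

/-- Separates the outcomes of a round: no survivor, exactly one, or several. -/
theorem sum_powerset_eq {α M : Type*} [DecidableEq α] [AddCommMonoid M] (S : Finset α)
    (F : Finset α → M) :
    ∑ A ∈ S.powerset, F A =
      F ∅ + ∑ i ∈ S, F {i} + ∑ A ∈ S.powerset with 1 < A.card, F A := by
  rw [← Finset.sum_filter_not_add_sum_filter S.powerset (fun A => 1 < A.card) F]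
  congr 1
  have : S.powerset.filter (fun A => ¬ 1 < A.card) =
      insert ∅ (S.map ⟨fun i => ({i} : Finset α), Finset.singleton_injective⟩) := by
    ext A
    simp only [Finset.mem_filter, Finset.mem_powerset, not_lt, Finset.mem_insert, Finset.mem_map,
      Function.Embedding.coeFn_mk]
    constructor
    · rintro ⟨hA, hc⟩
      rcases A.eq_empty_or_nonempty with rfl | ⟨i, hi⟩
      · exact Or.inl rfl
      · refine Or.inr ⟨i, hA hi, ?_⟩
        have := Finset.card_le_one.1 hc
        ext j
        simp only [Finset.mem_singleton]
        exact ⟨fun h => h ▸ hi, fun hj => this j hj i hi⟩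
    · rintro (rfl | ⟨i, hi, rfl⟩)
      · simp
      · simpa using hi
  rw [this, Finset.sum_insert (by simp), Finset.sum_map]
  rfl

/-! ### One round of queries at a quantile -/

section threshold

variable {n : ℕ} {P : Measure (Fin n → ℝ)} {S : Finset (Fin n)} {τ : ℝ} {δ : ℝ≥0∞}

theorem lintegral_split_empty (P : Measure (Fin n → ℝ)) (S : Finset (Fin n)) (τ : ℝ)
    (f : (Fin n → ℝ) → ℝ≥0∞) :
    ∫⁻ x in (survivorEvent S τ ∅)ᶜ, f x ∂P =
      ∑ i ∈ S, ∫⁻ x in survivorEvent S τ {i}, f x ∂P +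
      ∑ A ∈ S.powerset with 1 < A.card, ∫⁻ x in survivorEvent S τ A, f x ∂P := by
  have h := lintegral_eq_sum_survivorEvent (P.restrict (survivorEvent S τ ∅)ᶜ) S τ f
  have hm := fun A => measurableSet_survivorEvent S τ A
  have hsub : ∀ A : Finset (Fin n), A ≠ ∅ →
      survivorEvent S τ A ∩ (survivorEvent S τ ∅)ᶜ = survivorEvent S τ A := fun A hA =>
    Set.inter_eq_left.2 (pairwise_disjoint_survivorEvent S τ hA).subset_compl_right
  rw [h, sum_powerset_eq]
  simp only [Measure.restrict_restrict (hm _)]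
  rw [Set.inter_compl_self, Measure.restrict_empty, lintegral_zero_measure, zero_add]
  congr 1
  · refine Finset.sum_congr rfl fun i _ => ?_
    rw [hsub _ (Finset.singleton_ne_empty i)]
  · refine Finset.sum_congr rfl fun A hA => ?_
    rw [hsub]
    rintro rfl
    simp at hA

/-- Weighted version of: given that some variable reaches the threshold, the probability that
only one does is at least that of none reaching it. -/
theorem IsProductLaw.mul_lintegral_compl_le (hP : IsProductLaw P)
    (hδ : P (survivorEvent S τ ∅) = δ * P Set.univ) {g : ℝ → ℝ≥0∞} (hg : Measurable g)
    {f : (Fin n → ℝ) → ℝ≥0∞}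
    (hf : ∀ x ∉ survivorEvent S τ ∅, ∃ i ∈ S, τ ≤ x i ∧ f x ≤ g (x i)) :
    δ * ∫⁻ x in (survivorEvent S τ ∅)ᶜ, f x ∂P ≤
      ∑ i ∈ S, ∫⁻ x in survivorEvent S τ {i}, g (x i) ∂P := by
  have hm : ∀ i : Fin n, MeasurableSet {x : Fin n → ℝ | τ ≤ x i} := fun i =>
    measurableSet_le measurable_const (measurable_pi_apply i)
  -- A union bound: `f` is dominated by the sum of `g (x i)` over all survivors `i`.
  have h1 : ∫⁻ x in (survivorEvent S τ ∅)ᶜ, f x ∂P ≤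
      ∑ i ∈ S, ∫⁻ x in {x | τ ≤ x i}, g (x i) ∂P := by
    simp_rw [← lintegral_indicator (hm _)]
    have hgi : ∀ i ∈ S, Measurable
        ({x : Fin n → ℝ | τ ≤ x i}.indicator fun x : Fin n → ℝ => g (x i)) := fun i _ =>
      (hg.comp (measurable_pi_apply i)).indicator (hm i)
    rw [← lintegral_finsetSum S hgi,
      ← lintegral_indicator (measurableSet_survivorEvent S τ ∅).compl]
    refine lintegral_mono fun x => ?_
    by_cases hx : x ∈ survivorEvent S τ ∅
    · simp [hx]
    · obtain ⟨i, hi, hix, hle⟩ := hf x hx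
      rw [Set.indicator_of_mem (by exact hx)]
      refine hle.trans (le_trans ?_ (Finset.single_le_sum
        (f := fun i => Set.indicator {x : Fin n → ℝ | τ ≤ x i} (fun x => g (x i)) x)
        (fun _ _ => zero_le) hi))
      simp [Set.indicator, hix]
  calc δ * ∫⁻ x in (survivorEvent S τ ∅)ᶜ, f x ∂P
      ≤ δ * ∑ i ∈ S, ∫⁻ x in {x | τ ≤ x i}, g (x i) ∂P := by gcongr
    _ = ∑ i ∈ S, δ * ∫⁻ x in {x | τ ≤ x i}, g (x i) ∂P := Finset.mul_sum _ _ _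
    _ ≤ _ := Finset.sum_le_sum fun i hi => hP.mul_setLIntegral_le hδ hi hg

theorem sum_lintegral_singleton_eq (P : Measure (Fin n → ℝ)) (S : Finset (Fin n)) (τ : ℝ) :
    ∑ i ∈ S, ∫⁻ x in survivorEvent S τ {i}, ENNReal.ofReal (x i) ∂P =
      ∑ i ∈ S, ∫⁻ x in survivorEvent S τ {i}, maxOver S x ∂P := by
  refine Finset.sum_congr rfl fun i hi => ?_
  refine setLIntegral_congr_fun (measurableSet_survivorEvent S τ {i}) fun x hx => ?_
  rw [← maxOver_singleton, maxOver_eq_of_mem_survivorEvent (Finset.singleton_subset_iff.2 hi)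
    (Finset.singleton_nonempty i) hx]

theorem IsProductLaw.mul_lintegral_maxOver_compl_le (hP : IsProductLaw P)
    (hδ : P (survivorEvent S τ ∅) = δ * P Set.univ) :
    δ * ∫⁻ x in (survivorEvent S τ ∅)ᶜ, maxOver S x ∂P ≤
      ∑ i ∈ S, ∫⁻ x in survivorEvent S τ {i}, maxOver S x ∂P := by
  rw [← sum_lintegral_singleton_eq]
  refine hP.mul_lintegral_compl_le hδ ENNReal.measurable_ofReal fun x hx => ?_
  obtain ⟨i, hi, hix, h⟩ := exists_maxOver_eq_of_notMem_survivorEvent_empty hx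
  exact ⟨i, hi, hix, h.le⟩

theorem IsProductLaw.mul_measure_compl_le (hP : IsProductLaw P)
    (hδ : P (survivorEvent S τ ∅) = δ * P Set.univ) :
    δ * P (survivorEvent S τ ∅)ᶜ ≤ ∑ i ∈ S, P (survivorEvent S τ {i}) := by
  simpa using hP.mul_lintegral_compl_le hδ (g := fun _ => 1) measurable_const (f := fun _ => 1)
    fun x hx => by simpa using exists_le_of_notMem_survivorEvent_empty hx

theorem measure_univ_le_two_mul_compl [IsFiniteMeasure P]
    (hδ : P (survivorEvent S τ ∅) = δ * P Set.univ) (h : δ ≤ 2⁻¹) :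
    P Set.univ ≤ 2 * P (survivorEvent S τ ∅)ᶜ := by
  have hle : 2 * P (survivorEvent S τ ∅) ≤ P Set.univ := by
    rw [hδ]
    calc 2 * (δ * P Set.univ) ≤ 2 * (2⁻¹ * P Set.univ) := by gcongr
      _ = P Set.univ := by
        rw [← mul_assoc, ENNReal.mul_inv_cancel (by norm_num) (by norm_num), one_mul]
  have hadd := measure_add_measure_compl (μ := P) (measurableSet_survivorEvent S τ ∅)
  refine (ENNReal.add_le_add_iff_left (measure_ne_top P Set.univ)).1 ?_
  calc P Set.univ + P Set.univ
      = 2 * P (survivorEvent S τ ∅) + 2 * P (survivorEvent S τ ∅)ᶜ := by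
        rw [← mul_add, hadd, two_mul]
    _ ≤ _ := by gcongr

/-- The maximum is below `τ` without survivors and at least `τ` with one, so comparing the two
integrals reduces to comparing probabilities; some survivor exists with relative probability at
least one half. -/
theorem lintegral_maxOver_empty_le [IsFiniteMeasure P]
    (hδ : P (survivorEvent S τ ∅) = δ * P Set.univ) (h : δ ≤ 2⁻¹) :
    ∫⁻ x in survivorEvent S τ ∅, maxOver S x ∂P ≤
      2 * δ * ∫⁻ x in (survivorEvent S τ ∅)ᶜ, maxOver S x ∂P := by
  have hm := measurableSet_survivorEvent S τ ∅
  have h1 : ∫⁻ x in survivorEvent S τ ∅, maxOver S x ∂P ≤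
      ENNReal.ofReal τ * P (survivorEvent S τ ∅) := by
    rw [← setLIntegral_const]
    refine setLIntegral_mono' hm fun x hx => Finset.sup_le fun i hi => ?_
    exact ENNReal.ofReal_le_ofReal (mem_survivorEvent_empty.1 hx i hi).le
  have h2 : ENNReal.ofReal τ * P (survivorEvent S τ ∅)ᶜ ≤
      ∫⁻ x in (survivorEvent S τ ∅)ᶜ, maxOver S x ∂P := by
    rw [← setLIntegral_const]
    refine setLIntegral_mono' hm.compl fun x hx => ?_
    obtain ⟨i, hi, hix⟩ := exists_le_of_notMem_survivorEvent_empty hx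
    exact (ENNReal.ofReal_le_ofReal hix).trans (le_maxOver hi x)
  have h3 := measure_univ_le_two_mul_compl hδ h
  calc _ ≤ ENNReal.ofReal τ * (δ * P Set.univ) := by rwa [← hδ]
    _ ≤ ENNReal.ofReal τ * (δ * (2 * P (survivorEvent S τ ∅)ᶜ)) := by gcongr
    _ = 2 * δ * (ENNReal.ofReal τ * P (survivorEvent S τ ∅)ᶜ) := by ring
    _ ≤ _ := by gcongr

end threshold

/-- Here `u`, `o`, `m` are the masses of no, one and several survivors. The hypotheses give `m ≤ o`
and `u ≤ 2 * o`, so the unresolved mass `u + m` is at most three quarters of the total. -/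
theorem ENNReal.four_mul_add_le {u o m : ℝ≥0∞} (hu : u ≤ o + m) (hm : 2⁻¹ * (o + m) ≤ o) :
    4 * (u + m) ≤ 3 * (u + o + m) := by
  rcases eq_or_ne o ⊤ with rfl | ho
  · simp
  have hmo : m ≤ o := by
    have h := mul_le_mul_right hm 2
    rw [← mul_assoc, ENNReal.mul_inv_cancel (by norm_num) (by norm_num), one_mul, two_mul] at h
    exact (ENNReal.add_le_add_iff_left ho).1 h
  have h : u + m ≤ 3 * o := by
    calc u + m ≤ (o + o) + o := add_le_add (hu.trans (by gcongr)) hmo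
      _ = 3 * o := by ring
  calc 4 * (u + m) = 3 * (u + m) + (u + m) := by ring
    _ ≤ 3 * (u + m) + 3 * o := by gcongr
    _ = _ := by ring

/-! ### Median search -/

/-- A threshold that the maximum over `S` stays below with (relative) probability `δ`. -/
noncomputable def quantile {n : ℕ} (P : Measure (Fin n → ℝ)) (S : Finset (Fin n)) (δ : ℝ≥0∞) : ℝ :=
  Classical.epsilon fun τ => P (survivorEvent S τ ∅) = δ * P Set.univ

theorem IsProductLaw.measure_quantile {n : ℕ} {P : Measure (Fin n → ℝ)} (hP : IsProductLaw P)
    {S : Finset (Fin n)} (hS : S.Nonempty) {δ : ℝ≥0∞} (h0 : δ ≠ 0) (h1 : δ < 1) :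
    P (survivorEvent S (quantile P S δ) ∅) = δ * P Set.univ :=
  Classical.epsilon_spec (hP.exists_quantile hS h0 h1)

/-- The variables that can still be maximal when the survivors in `S` are `S'`. -/
def candidates {n : ℕ} (S S' : Finset (Fin n)) : Finset (Fin n) :=
  if S' = ∅ then S else S'

section candidates

variable {n : ℕ} {S S' : Finset (Fin n)}

theorem candidates_subset (h : S' ⊆ S) : candidates S S' ⊆ S := by
  unfold candidates
  split_ifs
  · exact subset_rfl
  · exact h

theorem candidates_nonempty (hS : S.Nonempty) : (candidates S S').Nonempty := by
  unfold candidates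
  split_ifs with h
  · exact hS
  · exact Finset.nonempty_iff_ne_empty.2 h

theorem maxOver_eq_candidates {τ : ℝ} {x : Fin n → ℝ} (h : S' ⊆ S)
    (hx : x ∈ survivorEvent S τ S') : maxOver S x = maxOver (candidates S S') x := by
  unfold candidates
  split_ifs with h'
  · rfl
  · exact maxOver_eq_of_mem_survivorEvent h (Finset.nonempty_iff_ne_empty.2 h') hx

end candidates

/-- Median search: query all candidates against the median of their maximum until only one
survives, for at most `r` rounds. Here `P` is the joint law restricted to the event known. -/
noncomputable def search {n : ℕ} [NeZero n] :
    ℕ → Finset (Fin n) → Measure (Fin n → ℝ) → QueryTree n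
  -- When the rounds run out the choice is arbitrary; the analysis counts its value as lost.
  | 0, _, _ => .select 0
  | r + 1, S, P => .scan S (quantile P S 2⁻¹) fun S' =>
      open Classical in
      if h : ∃ i, S' = {i} then .select h.choose
      else search r (candidates S S') (P.restrict (survivorEvent S (quantile P S 2⁻¹) S'))

theorem ne_singleton_of_one_lt_card {n : ℕ} {A : Finset (Fin n)} (h : 1 < A.card) (i : Fin n) :
    A ≠ {i} := by
  rintro rfl
  simp at h

section search

variable {n : ℕ} [NeZero n]

/-- The continuation of the median search after a round. -/
noncomputable def searchStep (r : ℕ) (S : Finset (Fin n)) (P : Measure (Fin n → ℝ))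
    (S' : Finset (Fin n)) : QueryTree n :=
  open Classical in
  if h : ∃ i, S' = {i} then .select h.choose
  else search r (candidates S S') (P.restrict (survivorEvent S (quantile P S 2⁻¹) S'))

theorem search_succ (r : ℕ) (S : Finset (Fin n)) (P : Measure (Fin n → ℝ)) :
    search (r + 1) S P = .scan S (quantile P S 2⁻¹) (searchStep r S P) := rfl

theorem searchStep_singleton (r : ℕ) (S : Finset (Fin n)) (P : Measure (Fin n → ℝ)) (i : Fin n) :
    searchStep r S P {i} = .select i := by
  have h : ∃ j, ({i} : Finset (Fin n)) = {j} := ⟨i, rfl⟩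
  rw [searchStep, dif_pos h]
  congr 1
  exact (Finset.singleton_injective h.choose_spec).symm

theorem searchStep_of_ne (r : ℕ) (S : Finset (Fin n)) (P : Measure (Fin n → ℝ))
    {S' : Finset (Fin n)} (h : ∀ i, S' ≠ {i}) :
    searchStep r S P S' =
      search r (candidates S S') (P.restrict (survivorEvent S (quantile P S 2⁻¹) S')) := by
  rw [searchStep, dif_neg (not_exists.2 h)]

theorem numQueries_search_le (r : ℕ) (S : Finset (Fin n)) (P : Measure (Fin n → ℝ))
    (x : Fin n → ℝ) : (search r S P).numQueries x ≤ S.card * r := by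
  induction r generalizing S P with
  | zero => simp [search]
  | succ r ih =>
    rw [search_succ, QueryTree.numQueries_scan, mul_add, mul_one, add_comm]
    gcongr
    by_cases h : ∃ i, QueryTree.survivors S (quantile P S 2⁻¹) x = {i}
    · obtain ⟨i, hi⟩ := h
      simp [hi, searchStep_singleton]
    · rw [searchStep_of_ne _ _ _ (not_exists.1 h)]
      refine (ih _ _).trans ?_
      gcongr
      exact candidates_subset (Finset.filter_subset _ _)

theorem lintegral_search (r : ℕ) (S : Finset (Fin n)) (P : Measure (Fin n → ℝ)) :
    ∫⁻ x, ENNReal.ofReal (x ((search (r + 1) S P).choice x)) ∂P =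
      ∑ A ∈ S.powerset, ∫⁻ x in survivorEvent S (quantile P S 2⁻¹) A,
        ENNReal.ofReal (x ((searchStep r S P A).choice x)) ∂P := by
  rw [lintegral_eq_sum_survivorEvent P S (quantile P S 2⁻¹)]
  refine Finset.sum_congr rfl fun A _ => ?_
  refine setLIntegral_congr_fun (measurableSet_survivorEvent _ _ _) fun x hx => ?_
  have hx' : QueryTree.survivors S (quantile P S 2⁻¹) x = A := hx
  rw [search_succ, QueryTree.choice_scan, hx']

theorem two_inv_ne_zero_and_lt_one : (2⁻¹ : ℝ≥0∞) ≠ 0 ∧ (2⁻¹ : ℝ≥0∞) < 1 :=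
  ⟨by simp, ENNReal.inv_lt_one.2 (by norm_num)⟩

/-- The median search loses at most a fraction `(3/4) ^ r` of the expected maximum. -/
theorem lintegral_maxOver_le_search (r : ℕ) {S : Finset (Fin n)} (hS : S.Nonempty)
    {P : Measure (Fin n → ℝ)} (hP : IsProductLaw P) :
    ∫⁻ x, maxOver S x ∂P ≤ ∫⁻ x, ENNReal.ofReal (x ((search r S P).choice x)) ∂P +
      (3 / 4) ^ r * ∫⁻ x, maxOver S x ∂P := by
  induction r generalizing S P with
  | zero => simp
  | succ r ih =>
    have := hP.isFiniteMeasure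
    have hδ := hP.measure_quantile hS two_inv_ne_zero_and_lt_one.1 two_inv_ne_zero_and_lt_one.2
    rw [lintegral_search]
    set τ := quantile P S 2⁻¹
    set I : Finset (Fin n) → ℝ≥0∞ := fun A => ∫⁻ x in survivorEvent S τ A, maxOver S x ∂P with hI
    set J : Finset (Fin n) → ℝ≥0∞ := fun A => ∫⁻ x in survivorEvent S τ A,
      ENNReal.ofReal (x ((searchStep r S P A).choice x)) ∂P with hJ
    have hIsum : ∫⁻ x, maxOver S x ∂P = ∑ A ∈ S.powerset, I A :=
      lintegral_eq_sum_survivorEvent P S τ _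
    have hstep : ∀ A ⊆ S, (∀ i, A ≠ {i}) → I A ≤ J A + (3 / 4) ^ r * I A := by
      intro A hA hne
      have h := ih (candidates_nonempty (S' := A) hS) (hP.restrict_survivorEvent hA τ)
      have e : I A = ∫⁻ x in survivorEvent S τ A, maxOver (candidates S A) x ∂P :=
        setLIntegral_congr_fun (measurableSet_survivorEvent _ _ _) fun x hx =>
          maxOver_eq_candidates hA hx
      rw [e]
      simpa only [hJ, searchStep_of_ne r S P hne] using h
    have hone : ∀ i ∈ S, I {i} ≤ J {i} := by
      intro i hi
      refine setLIntegral_mono' (measurableSet_survivorEvent _ _ _) fun x hx => ?_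
      rw [searchStep_singleton, maxOver_eq_of_mem_survivorEvent
        (Finset.singleton_subset_iff.2 hi) (Finset.singleton_nonempty i) hx, maxOver_singleton]
      rfl
    -- Both hypotheses of the three-quarters bound are the median case of the round estimates
    -- weighted by the maximum.
    have hloss : 4 * (I ∅ + ∑ A ∈ S.powerset with 1 < A.card, I A) ≤
        3 * ∑ A ∈ S.powerset, I A := by
      rw [sum_powerset_eq]
      have h1 := lintegral_maxOver_empty_le hδ le_rfl
      have h2 := hP.mul_lintegral_maxOver_compl_le hδ
      rw [ENNReal.mul_inv_cancel (by norm_num) (by norm_num), one_mul] at h1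
      rw [lintegral_split_empty] at h1 h2
      exact ENNReal.four_mul_add_le h1 h2
    have hloss' : I ∅ + ∑ A ∈ S.powerset with 1 < A.card, I A ≤
        3 / 4 * ∑ A ∈ S.powerset, I A := by
      rw [ENNReal.div_eq_inv_mul, mul_assoc]
      rw [← ENNReal.mul_le_mul_iff_right (a := 4) (by norm_num) (by norm_num), ← mul_assoc 4 4⁻¹,
        ENNReal.mul_inv_cancel (by norm_num) (by norm_num), one_mul]
      exact hloss
    rw [hIsum]
    calc ∑ A ∈ S.powerset, I A
        = I ∅ + ∑ i ∈ S, I {i} + ∑ A ∈ S.powerset with 1 < A.card, I A := sum_powerset_eq _ _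
      _ ≤ (J ∅ + (3 / 4) ^ r * I ∅) + ∑ i ∈ S, J {i} +
          ∑ A ∈ S.powerset with 1 < A.card, (J A + (3 / 4) ^ r * I A) := by
        refine add_le_add (add_le_add (hstep _ (Finset.empty_subset S) fun i =>
          (Finset.singleton_ne_empty i).symm) (Finset.sum_le_sum hone)) (Finset.sum_le_sum ?_)
        intro A hA
        rw [Finset.mem_filter, Finset.mem_powerset] at hA
        exact hstep A hA.1 (ne_singleton_of_one_lt_card hA.2)
      _ = ∑ A ∈ S.powerset, J A +
          (3 / 4) ^ r * (I ∅ + ∑ A ∈ S.powerset with 1 < A.card, I A) := by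
        rw [sum_powerset_eq, Finset.sum_add_distrib, ← Finset.mul_sum, mul_add]
        abel
      _ ≤ ∑ A ∈ S.powerset, J A + (3 / 4) ^ r * (3 / 4 * ∑ A ∈ S.powerset, I A) := by gcongr
      _ = _ := by rw [pow_succ, mul_assoc]

/-- The expected number of rounds of the median search is at most four. -/
theorem lintegral_load_search_le (r : ℕ) {S : Finset (Fin n)} (hS : S.Nonempty)
    {P : Measure (Fin n → ℝ)} (hP : IsProductLaw P) :
    ∫⁻ x, ((search r S P).load x : ℝ≥0∞) ∂P ≤ 4 * P Set.univ := by
  induction r generalizing S P with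
  | zero => simp [search]
  | succ r ih =>
    have := hP.isFiniteMeasure
    have hδ := hP.measure_quantile hS two_inv_ne_zero_and_lt_one.1 two_inv_ne_zero_and_lt_one.2
    have hP1 := fun f => lintegral_eq_sum_survivorEvent P S (quantile P S 2⁻¹) f
    have hload : ∀ A ∈ S.powerset, ∀ x ∈ survivorEvent S (quantile P S 2⁻¹) A,
        ((search (r + 1) S P).load x : ℝ≥0∞) ≤ 1 + ((searchStep r S P A).load x : ℝ≥0∞) := by
      intro A _ x hx
      have hx' : QueryTree.survivors S (quantile P S 2⁻¹) x = A := hx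
      have := QueryTree.load_scan_le S (quantile P S 2⁻¹) (searchStep r S P) x
      rw [hx'] at this
      rw [search_succ]
      exact_mod_cast this
    set τ := quantile P S 2⁻¹
    set J : Finset (Fin n) → ℝ≥0∞ := fun A => ∫⁻ x in survivorEvent S τ A,
      ((searchStep r S P A).load x : ℝ≥0∞) ∂P with hJ
    set I : Finset (Fin n) → ℝ≥0∞ := fun A => P (survivorEvent S τ A) with hI
    have hIsum : P Set.univ = ∑ A ∈ S.powerset, I A := by
      simpa using hP1 fun _ => 1
    have hstep : ∀ A ⊆ S, (∀ i, A ≠ {i}) → J A ≤ 4 * I A := by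
      intro A hA hne
      have h := ih (candidates_nonempty (S' := A) hS) (hP.restrict_survivorEvent hA τ)
      simpa only [hJ, searchStep_of_ne r S P hne, Measure.restrict_apply_univ] using h
    have hone : ∀ i ∈ S, J {i} = 0 := by
      intro i hi
      simp [hJ, searchStep_singleton]
    -- The same bound for probabilities: the search continues on at most three quarters of the mass,
    -- which closes the recursion as `1 + (3/4) * 4 = 4`.
    have hloss : 4 * (I ∅ + ∑ A ∈ S.powerset with 1 < A.card, I A) ≤
        3 * ∑ A ∈ S.powerset, I A := by
      rw [sum_powerset_eq]
      have h2 := hP.mul_measure_compl_le hδ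
      have hc : P (survivorEvent S τ ∅)ᶜ =
          ∑ i ∈ S, I {i} + ∑ A ∈ S.powerset with 1 < A.card, I A := by
        simpa using lintegral_split_empty P S τ fun _ => 1
      have h1 : P (survivorEvent S τ ∅) ≤ P (survivorEvent S τ ∅)ᶜ := by
        calc P (survivorEvent S τ ∅) = 2⁻¹ * P Set.univ := hδ
          _ ≤ 2⁻¹ * (2 * P (survivorEvent S τ ∅)ᶜ) := by
            gcongr
            exact measure_univ_le_two_mul_compl hδ le_rfl
          _ = P (survivorEvent S τ ∅)ᶜ := by
            rw [← mul_assoc, ENNReal.inv_mul_cancel (by norm_num) (by norm_num), one_mul]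
      rw [hc] at h1 h2
      exact ENNReal.four_mul_add_le h1 h2
    rw [hP1]
    calc ∑ A ∈ S.powerset, ∫⁻ x in survivorEvent S τ A, ((search (r + 1) S P).load x : ℝ≥0∞) ∂P
        ≤ ∑ A ∈ S.powerset, (I A + J A) := by
          refine Finset.sum_le_sum fun A hA => ?_
          refine (setLIntegral_mono' (measurableSet_survivorEvent _ _ _) (hload A hA)).trans_eq ?_
          rw [lintegral_add_left measurable_const, setLIntegral_one]
      _ = ∑ A ∈ S.powerset, I A +
          (J ∅ + ∑ i ∈ S, J {i} + ∑ A ∈ S.powerset with 1 < A.card, J A) := by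
          rw [Finset.sum_add_distrib, sum_powerset_eq S J]
      _ ≤ ∑ A ∈ S.powerset, I A +
          (4 * I ∅ + 0 + ∑ A ∈ S.powerset with 1 < A.card, 4 * I A) := by
          gcongr with A hA
          · exact hstep _ (Finset.empty_subset S) fun i => (Finset.singleton_ne_empty i).symm
          · rw [Finset.sum_eq_zero hone]
          · rw [Finset.mem_filter, Finset.mem_powerset] at hA
            exact hstep A hA.1 (ne_singleton_of_one_lt_card hA.2)
      _ = ∑ A ∈ S.powerset, I A + 4 * (I ∅ + ∑ A ∈ S.powerset with 1 < A.card, I A) := by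
          rw [← Finset.mul_sum, add_zero, mul_add]
      _ ≤ ∑ A ∈ S.powerset, I A + 3 * ∑ A ∈ S.powerset, I A := by gcongr
      _ = _ := by rw [hIsum]; ring

end search

/-! ### The sweep at a low quantile -/

section sweep

variable {n : ℕ}

/-- The expectation of the maximum times the number of survivors. -/
theorem IsProductLaw.mul_lintegral_card_mul_maxOver_le {P : Measure (Fin n → ℝ)}
    [IsProbabilityMeasure P] (hP : IsProductLaw P) {S : Finset (Fin n)} {τ : ℝ} {δ : ℝ≥0∞}
    (hδ : P (survivorEvent S τ ∅) = δ * P Set.univ) :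
    δ * ∫⁻ x, ((QueryTree.survivors S τ x).card : ℝ≥0∞) * maxOver S x ∂P ≤
      2 * ∫⁻ x, maxOver S x ∂P := by
  have hm : ∀ i : Fin n, MeasurableSet {x : Fin n → ℝ | τ ≤ x i} := fun i =>
    measurableSet_le measurable_const (measurable_pi_apply i)
  have h1 : ∫⁻ x, ((QueryTree.survivors S τ x).card : ℝ≥0∞) * maxOver S x ∂P =
      ∑ i ∈ S, ∫⁻ x in {x | τ ≤ x i}, maxOver S x ∂P := by
    simp_rw [← lintegral_indicator (hm _)]
    rw [← lintegral_finsetSum S fun i _ => (measurable_maxOver S).indicator (hm i)]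
    refine lintegral_congr fun x => ?_
    simp only [QueryTree.survivors, Finset.card_filter, Nat.cast_sum, Finset.sum_mul]
    refine Finset.sum_congr rfl fun i _ => ?_
    by_cases h : τ ≤ x i <;> simp [h]
  -- Bound the maximum by `x i` plus the maximum of the others. The first part is charged to the
  -- event that only `i` survives; the second is independent of `x i`, so only the probability of
  -- reaching `τ` is charged. These events are disjoint, so each part sums to at most one expected
  -- maximum.
  have h2 : ∀ i ∈ S, δ * ∫⁻ x in {x | τ ≤ x i}, maxOver S x ∂P ≤
      ∫⁻ x in survivorEvent S τ {i}, ENNReal.ofReal (x i) ∂P +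
        P (survivorEvent S τ {i}) * ∫⁻ x, maxOver S x ∂P := by
    intro i hi
    have hle : ∀ x, maxOver S x ≤ ENNReal.ofReal (x i) + maxOver (S.erase i) x := by
      intro x
      refine Finset.sup_le fun j hj => ?_
      rcases eq_or_ne j i with rfl | hji
      · exact le_self_add
      · exact (le_maxOver (Finset.mem_erase.2 ⟨hji, hj⟩) x).trans le_add_self
    have ha := hP.mul_setLIntegral_le hδ hi ENNReal.measurable_ofReal
    have hb := hP.mul_setLIntegral_le hδ hi (g := fun _ => 1) measurable_const
    have hc := hP.lintegral_mul i (f := (Set.Ici τ).indicator 1)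
      (measurable_one.indicator measurableSet_Ici) (measurable_maxOver (S.erase i)) (by
        intro x t
        refine Finset.sup_congr rfl fun j hj => ?_
        rw [Function.update_of_ne (Finset.ne_of_mem_erase hj)])
    have e1 : ∫⁻ x, (Set.Ici τ).indicator 1 (x i) ∂P = P {x | τ ≤ x i} := by
      rw [← lintegral_indicator_one (hm i)]
      rfl
    have e2 : ∫⁻ x, (Set.Ici τ).indicator 1 (x i) * maxOver (S.erase i) x ∂P =
        ∫⁻ x in {x | τ ≤ x i}, maxOver (S.erase i) x ∂P := by
      rw [← lintegral_indicator (hm i)]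
      refine lintegral_congr fun x => ?_
      by_cases h : τ ≤ x i <;> simp [Set.indicator, h]
    rw [e1, e2, measure_univ, one_mul] at hc
    simp only [setLIntegral_one] at hb
    calc δ * ∫⁻ x in {x | τ ≤ x i}, maxOver S x ∂P
        ≤ δ * ∫⁻ x in {x | τ ≤ x i}, (ENNReal.ofReal (x i) + maxOver (S.erase i) x) ∂P := by
          gcongr with x
          exact hle x
      _ = δ * ∫⁻ x in {x | τ ≤ x i}, ENNReal.ofReal (x i) ∂P +
          δ * P {x | τ ≤ x i} * ∫⁻ x, maxOver (S.erase i) x ∂P := by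
          rw [lintegral_add_left (measurable_pi_apply i).ennreal_ofReal, hc, mul_add, mul_assoc]
      _ ≤ _ := by
          gcongr with x
          exact maxOver_mono (Finset.erase_subset i S) _
  have hsplit := lintegral_split_empty P S τ
  have h3 : ∑ i ∈ S, ∫⁻ x in survivorEvent S τ {i}, ENNReal.ofReal (x i) ∂P ≤
      ∫⁻ x, maxOver S x ∂P := by
    rw [sum_lintegral_singleton_eq]
    exact le_self_add.trans ((hsplit (maxOver S)).symm.trans_le (setLIntegral_le_lintegral _ _))
  have h4 : ∑ i ∈ S, P (survivorEvent S τ {i}) ≤ 1 := by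
    have h := hsplit fun _ => 1
    simp only [setLIntegral_one] at h
    exact le_self_add.trans (h.symm.trans_le prob_le_one)
  rw [h1, Finset.mul_sum]
  calc _ ≤ _ := Finset.sum_le_sum h2
    _ = ∑ i ∈ S, ∫⁻ x in survivorEvent S τ {i}, ENNReal.ofReal (x i) ∂P +
        (∑ i ∈ S, P (survivorEvent S τ {i})) * ∫⁻ x, maxOver S x ∂P := by
      rw [Finset.sum_add_distrib, Finset.sum_mul]
    _ ≤ ∫⁻ x, maxOver S x ∂P + 1 * ∫⁻ x, maxOver S x ∂P := by gcongr
    _ = _ := by ring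

variable [NeZero n]

/-- The continuation of `sweep`: a median search for `q` rounds among the survivors, unless there
are none or more than `q ^ 2`. -/
noncomputable def sweepStep (q : ℕ) (S : Finset (Fin n)) (P : Measure (Fin n → ℝ))
    (S' : Finset (Fin n)) : QueryTree n :=
  open Classical in
  if S'.Nonempty ∧ S'.card ≤ q ^ 2 then
    search q S' (P.restrict (survivorEvent S (quantile P S (q : ℝ≥0∞)⁻¹) S'))
  else .select 0

/-- Query every member of `S` against the threshold that their maximum stays below with
probability `1 / q`, and continue with a median search among the survivors. -/
noncomputable def sweep (q : ℕ) (S : Finset (Fin n)) (P : Measure (Fin n → ℝ)) : QueryTree n :=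
  .scan S (quantile P S (q : ℝ≥0∞)⁻¹) (sweepStep q S P)

theorem numQueries_sweep_le (q : ℕ) (S : Finset (Fin n)) (P : Measure (Fin n → ℝ))
    (x : Fin n → ℝ) : (sweep q S P).numQueries x ≤ S.card + q ^ 3 := by
  rw [sweep, QueryTree.numQueries_scan, sweepStep]
  gcongr
  split_ifs with h
  · refine (numQueries_search_le _ _ _ _).trans ?_
    rw [pow_succ]
    gcongr
    exact h.2
  · simp

theorem inv_natCast_bounds {q : ℕ} (hq : 2 ≤ q) :
    (q : ℝ≥0∞)⁻¹ ≠ 0 ∧ (q : ℝ≥0∞)⁻¹ < 1 ∧ (q : ℝ≥0∞)⁻¹ ≤ 2⁻¹ :=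
  ⟨by simp, ENNReal.inv_lt_one.2 (by exact_mod_cast hq),
    ENNReal.inv_le_inv.2 (by exact_mod_cast hq)⟩

/-- One for the sweep and four for the median search. -/
theorem lintegral_load_sweep_le {q : ℕ} {S : Finset (Fin n)}
    {P : Measure (Fin n → ℝ)} [IsProbabilityMeasure P] (hP : IsProductLaw P) :
    ∫⁻ x, ((sweep q S P).load x : ℝ≥0∞) ∂P ≤ 5 := by
  set τ := quantile P S (q : ℝ≥0∞)⁻¹ with hτ
  have hsum : ∑ A ∈ S.powerset, P (survivorEvent S τ A) = 1 := by
    have := lintegral_eq_sum_survivorEvent P S τ fun _ => 1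
    simpa using this.symm
  rw [lintegral_eq_sum_survivorEvent P S τ]
  calc ∑ A ∈ S.powerset, ∫⁻ x in survivorEvent S τ A, ((sweep q S P).load x : ℝ≥0∞) ∂P
      ≤ ∑ A ∈ S.powerset, 5 * P (survivorEvent S τ A) := by
        refine Finset.sum_le_sum fun A hA => ?_
        rw [Finset.mem_powerset] at hA
        calc ∫⁻ x in survivorEvent S τ A, ((sweep q S P).load x : ℝ≥0∞) ∂P
            ≤ ∫⁻ x in survivorEvent S τ A, (1 + ((sweepStep q S P A).load x : ℝ≥0∞)) ∂P := by
              refine setLIntegral_mono' (measurableSet_survivorEvent _ _ _) fun x hx => ?_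
              have hx' : QueryTree.survivors S τ x = A := hx
              have := QueryTree.load_scan_le S τ (sweepStep q S P) x
              rw [hx'] at this
              exact_mod_cast this
          _ = P (survivorEvent S τ A) +
              ∫⁻ x in survivorEvent S τ A, ((sweepStep q S P A).load x : ℝ≥0∞) ∂P := by
              rw [lintegral_add_left measurable_const, setLIntegral_one]
          _ ≤ P (survivorEvent S τ A) + 4 * P (survivorEvent S τ A) := by
              gcongr
              rw [sweepStep]
              split_ifs with h
              · simpa using lintegral_load_search_le q h.1 (hP.restrict_survivorEvent hA τ)
              · simp
          _ = 5 * P (survivorEvent S τ A) := by ring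
    _ = 5 := by rw [← Finset.mul_sum, hsum, mul_one]

/-- The loss is `2/q` for no survivor, `2/q` for more than `q ^ 2` survivors, and `(3/4) ^ q` for
the search. -/
theorem lintegral_maxOver_le_sweep {q : ℕ} (hq : 2 ≤ q) {S : Finset (Fin n)} (hS : S.Nonempty)
    {P : Measure (Fin n → ℝ)} [IsProbabilityMeasure P] (hP : IsProductLaw P) :
    ∫⁻ x, maxOver S x ∂P ≤ ∫⁻ x, ENNReal.ofReal (x ((sweep q S P).choice x)) ∂P +
      (4 * (q : ℝ≥0∞)⁻¹ + (3 / 4) ^ q) * ∫⁻ x, maxOver S x ∂P := by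
  obtain ⟨hq0, hq1, hq2⟩ := inv_natCast_bounds hq
  have hqc : (q : ℝ≥0∞) ≠ 0 := by
    have : q ≠ 0 := by omega
    exact_mod_cast this
  have hqt : (q : ℝ≥0∞) ≠ ⊤ := ENNReal.natCast_ne_top q
  have hδ := hP.measure_quantile hS hq0 hq1
  set τ := quantile P S (q : ℝ≥0∞)⁻¹ with hτ
  set M := ∫⁻ x, maxOver S x ∂P with hM
  set I : Finset (Fin n) → ℝ≥0∞ := fun A => ∫⁻ x in survivorEvent S τ A, maxOver S x ∂P with hI
  set J : Finset (Fin n) → ℝ≥0∞ := fun A => ∫⁻ x in survivorEvent S τ A,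
    ENNReal.ofReal (x ((sweepStep q S P A).choice x)) ∂P with hJ
  have hIsum : M = ∑ A ∈ S.powerset, I A := lintegral_eq_sum_survivorEvent P S τ _
  have hJsum : ∫⁻ x, ENNReal.ofReal (x ((sweep q S P).choice x)) ∂P =
      ∑ A ∈ S.powerset, J A := by
    rw [lintegral_eq_sum_survivorEvent P S τ]
    refine Finset.sum_congr rfl fun A _ => ?_
    refine setLIntegral_congr_fun (measurableSet_survivorEvent _ _ _) fun x hx => ?_
    have hx' : QueryTree.survivors S τ x = A := hx
    rw [sweep, QueryTree.choice_scan, hx']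
  have hnone : I ∅ ≤ 2 * (q : ℝ≥0∞)⁻¹ * M :=
    (lintegral_maxOver_empty_le hδ hq2).trans (by gcongr; exact setLIntegral_le_lintegral _ _)
  -- Markov's inequality for the number of survivors weighted by the maximum, whose expectation is
  -- at most `2 * q * M`; dividing by `q ^ 2` leaves `2/q`.
  have hmany : ∑ A ∈ S.powerset with q ^ 2 < A.card, I A ≤ 2 * (q : ℝ≥0∞)⁻¹ * M := by
    set H := ∑ A ∈ S.powerset with q ^ 2 < A.card, I A
    have h1 : (q : ℝ≥0∞) ^ 2 * H ≤
        ∫⁻ x, ((QueryTree.survivors S τ x).card : ℝ≥0∞) * maxOver S x ∂P := by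
      rw [lintegral_eq_sum_survivorEvent P S τ, Finset.mul_sum]
      refine le_trans (Finset.sum_le_sum fun A hA => ?_)
        (Finset.sum_le_sum_of_subset (Finset.filter_subset (fun A : Finset (Fin n) => q ^ 2 < A.card) _))
      rw [← lintegral_const_mul _ (measurable_maxOver S)]
      refine setLIntegral_mono' (measurableSet_survivorEvent _ _ _) fun x hx => ?_
      have hx' : QueryTree.survivors S τ x = A := hx
      rw [hx']
      gcongr
      exact_mod_cast (Finset.mem_filter.1 hA).2.le
    have h2 : (q : ℝ≥0∞)⁻¹ * ((q : ℝ≥0∞) ^ 2 * H) ≤ 2 * M :=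
      (mul_le_mul_right h1 _).trans (hP.mul_lintegral_card_mul_maxOver_le hδ)
    calc H = (q : ℝ≥0∞)⁻¹ * ((q : ℝ≥0∞)⁻¹ * ((q : ℝ≥0∞) ^ 2 * H)) := by
          rw [pow_two, mul_assoc, ← mul_assoc _ (q : ℝ≥0∞) (_ * H), ENNReal.inv_mul_cancel hqc hqt,
            one_mul, ← mul_assoc, ENNReal.inv_mul_cancel hqc hqt, one_mul]
      _ ≤ (q : ℝ≥0∞)⁻¹ * (2 * M) := by gcongr
      _ = _ := by ring
  -- In the two abandoned cases all of `I A` is charged as loss, so that one sum covers every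
  -- outcome.
  have hstep : ∀ A ∈ S.powerset, I A ≤
      (J A + (3 / 4) ^ q * I A) + ((if A = ∅ then I A else 0) +
        (if q ^ 2 < A.card then I A else 0)) := by
    intro A hA
    rw [Finset.mem_powerset] at hA
    by_cases h0 : A = ∅
    · rw [if_pos h0]
      exact le_self_add.trans le_add_self
    by_cases h1 : q ^ 2 < A.card
    · rw [if_pos h1]
      exact le_add_self.trans le_add_self
    refine le_trans ?_ le_self_add
    have hA0 := Finset.nonempty_iff_ne_empty.2 h0
    have h := lintegral_maxOver_le_search q hA0 (hP.restrict_survivorEvent hA τ)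
    have e : I A = ∫⁻ x in survivorEvent S τ A, maxOver A x ∂P :=
      setLIntegral_congr_fun (measurableSet_survivorEvent _ _ _) fun x hx =>
        maxOver_eq_of_mem_survivorEvent hA hA0 hx
    rw [e]
    have hc : A.Nonempty ∧ A.card ≤ q ^ 2 := ⟨hA0, not_lt.1 h1⟩
    simpa only [hJ, sweepStep, if_pos hc] using h
  rw [hJsum]
  calc M = ∑ A ∈ S.powerset, I A := hIsum
    _ ≤ _ := Finset.sum_le_sum hstep
    _ = ∑ A ∈ S.powerset, J A + (3 / 4) ^ q * ∑ A ∈ S.powerset, I A +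
        (I ∅ + ∑ A ∈ S.powerset with q ^ 2 < A.card, I A) := by
      rw [Finset.sum_add_distrib, Finset.sum_add_distrib, Finset.sum_add_distrib, Finset.mul_sum,
        Finset.sum_ite_eq' _ _ _, if_pos (Finset.empty_mem_powerset S), Finset.sum_filter]
    _ ≤ ∑ A ∈ S.powerset, J A + (3 / 4) ^ q * M +
        (2 * (q : ℝ≥0∞)⁻¹ * M + 2 * (q : ℝ≥0∞)⁻¹ * M) := by
      rw [← hIsum]
      gcongr
    _ = _ := by ring

end sweep

/-! ### Freeing queries by dropping variables -/

/-- Some `q ^ 3` of at least `q ^ 4` variables can be dropped at a loss of at most `1 / q`. -/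
theorem exists_cheap_to_drop {n q : ℕ} (hq : 2 ≤ q) (hn : q ^ 4 ≤ n) (P : Measure (Fin n → ℝ)) :
    ∃ S : Finset (Fin n), S.Nonempty ∧ S.card + q ^ 3 ≤ n ∧
      ∫⁻ x, maxOver Finset.univ x ∂P ≤
        (q : ℝ≥0∞)⁻¹ * ∫⁻ x, maxOver Finset.univ x ∂P + ∫⁻ x, maxOver S x ∂P := by
  have hqc : (q : ℝ≥0∞) ≠ 0 := by
    have : q ≠ 0 := by omega
    exact_mod_cast this
  have hqt : (q : ℝ≥0∞) ≠ ⊤ := ENNReal.natCast_ne_top q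
  have hq4 : 2 ^ 4 ≤ q ^ 4 := Nat.pow_le_pow_left hq 4
  -- Removing one residue class modulo `q` destroys the maximum only if its index lies in that
  -- class, hence for at most one of the `q` classes. The best class to drop is then at least as
  -- good as the average.
  let keep : ℕ → Finset (Fin n) := fun b => Finset.univ.filter fun i => i.val % q ≠ b
  have hpt : ∀ x : Fin n → ℝ, (q : ℝ≥0∞) * maxOver Finset.univ x ≤
      maxOver Finset.univ x + ∑ b ∈ Finset.range q, maxOver (keep b) x := by
    intro x
    obtain ⟨i, -, hi⟩ := Finset.exists_max_image Finset.univ x ⟨⟨0, by omega⟩, Finset.mem_univ _⟩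
    have hmax : maxOver Finset.univ x = ENNReal.ofReal (x i) :=
      le_antisymm (Finset.sup_le fun k hk => ENNReal.ofReal_le_ofReal (hi k hk))
        (le_maxOver (Finset.mem_univ i) x)
    have hr : i.val % q ∈ Finset.range q := Finset.mem_range.2 (Nat.mod_lt _ (by omega))
    calc (q : ℝ≥0∞) * maxOver Finset.univ x
        = ∑ b ∈ Finset.range q, maxOver Finset.univ x := by simp
      _ = maxOver Finset.univ x + ∑ b ∈ (Finset.range q).erase (i.val % q),
          maxOver Finset.univ x := (Finset.add_sum_erase _ _ hr).symm
      _ ≤ maxOver Finset.univ x + ∑ b ∈ (Finset.range q).erase (i.val % q),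
          maxOver (keep b) x := by
        gcongr with b hb
        rw [hmax]
        refine le_maxOver ?_ x
        simp only [keep, Finset.mem_filter, Finset.mem_univ, true_and]
        exact (Finset.ne_of_mem_erase hb).symm
      _ ≤ _ := by
        gcongr
        exact Finset.erase_subset _ _
  obtain ⟨b, hb, hbmax⟩ := Finset.exists_max_image (Finset.range q)
    (fun b => ∫⁻ x, maxOver (keep b) x ∂P) ⟨0, Finset.mem_range.2 (by omega)⟩
  rw [Finset.mem_range] at hb
  refine ⟨keep b, ?_, ?_, ?_⟩
  · rcases Nat.eq_zero_or_pos b with rfl | hb0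
    · refine ⟨⟨1, by omega⟩, ?_⟩
      simp [keep, Nat.mod_eq_of_lt hq]
    · refine ⟨⟨0, by omega⟩, ?_⟩
      simp [keep, hb0.ne]
  · have hcard := Finset.card_filter_add_card_filter_not (s := (Finset.univ : Finset (Fin n)))
      fun i => i.val % q ≠ b
    rw [Finset.card_univ, Fintype.card_fin] at hcard
    refine le_trans (Nat.add_le_add_left ?_ _) hcard.le
    -- The dropped class contains `b + q * k` for all `k < q ^ 3`, since `q ^ 4 ≤ n`.
    have hlt : ∀ k < q ^ 3, b + q * k < n := by
      intro k hk
      have : q * (k + 1) ≤ q * q ^ 3 := Nat.mul_le_mul_left q hk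
      have e : q * q ^ 3 = q ^ 4 := by ring
      rw [e, mul_add, mul_one] at this
      omega
    calc q ^ 3 = (Finset.univ : Finset (Fin (q ^ 3))).card := by simp
      _ ≤ _ := by
        refine Finset.card_le_card_of_injOn (fun k => ⟨b + q * k.val, hlt k k.2⟩) ?_ ?_
        · intro k _
          simp [Nat.mod_eq_of_lt hb]
        · intro k _ l _ h
          have h' : b + q * k.val = b + q * l.val := congrArg Fin.val h
          exact Fin.ext (Nat.eq_of_mul_eq_mul_left (by omega) (Nat.add_left_cancel h'))
  · set M := ∫⁻ x, maxOver Finset.univ x ∂P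
    have h : (q : ℝ≥0∞) * M ≤ M + q * ∫⁻ x, maxOver (keep b) x ∂P := by
      calc (q : ℝ≥0∞) * M
          = ∫⁻ x, (q : ℝ≥0∞) * maxOver Finset.univ x ∂P :=
            (lintegral_const_mul _ (measurable_maxOver _)).symm
        _ ≤ ∫⁻ x, (maxOver Finset.univ x + ∑ b ∈ Finset.range q, maxOver (keep b) x) ∂P :=
            lintegral_mono hpt
        _ = M + ∑ b ∈ Finset.range q, ∫⁻ x, maxOver (keep b) x ∂P := by
            rw [lintegral_add_left (measurable_maxOver _),
              lintegral_finsetSum _ fun b _ => measurable_maxOver (keep b)]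
        _ ≤ M + ∑ _b ∈ Finset.range q, ∫⁻ x, maxOver (keep b) x ∂P := by
            refine add_le_add le_rfl (Finset.sum_le_sum hbmax)
        _ = _ := by simp
    calc M = (q : ℝ≥0∞)⁻¹ * (q * M) := by
          rw [← mul_assoc, ENNReal.inv_mul_cancel hqc hqt, one_mul]
      _ ≤ (q : ℝ≥0∞)⁻¹ * (M + q * ∫⁻ x, maxOver (keep b) x ∂P) := by gcongr
      _ = _ := by
          rw [mul_add, ← mul_assoc, ENNReal.inv_mul_cancel hqc hqt, one_mul]

/-! ### Iterated logarithm and elementary estimates -/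

/-- While an iterate exceeds 1, `log y ≤ y - 1` lowers it by at least one. Nonemptiness matters
because `sInf ∅ = 0` would make `logStar` vanish. -/
theorem exists_iterate_log_le_one (x : ℝ) : ∃ t : ℕ, Real.log^[t] x ≤ 1 := by
  by_contra! h
  have key : ∀ t : ℕ, Real.log^[t] x ≤ x - t := by
    intro t
    induction t with
    | zero => simp
    | succ t ih =>
      rw [Function.iterate_succ_apply']
      have := Real.log_le_sub_one_of_pos (zero_lt_one.trans (h t))
      push_cast
      linarith
  obtain ⟨t, ht⟩ := exists_nat_gt x
  linarith [key t, h t]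

theorem one_le_logStar {x : ℝ} (hx : 1 < x) : 1 ≤ logStar x := by
  rw [Nat.one_le_iff_ne_zero]
  intro h
  have hmem : Real.log^[logStar x] x ≤ 1 := Nat.sInf_mem (exists_iterate_log_le_one x)
  rw [h] at hmem
  exact hmem.not_gt hx

theorem prophetValue_eq_lintegral_maxOver {n : ℕ} [NeZero n] (P : Measure (Fin n → ℝ)) :
    prophetValue P = ∫⁻ x, maxOver Finset.univ x ∂P := by
  refine lintegral_congr fun x => le_antisymm ?_ (Finset.sup_le fun i _ => ?_)
  · obtain ⟨i, hi⟩ := Finite.exists_max x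
    exact (ENNReal.ofReal_le_ofReal (ciSup_le hi)).trans (le_maxOver (Finset.mem_univ i) x)
  · exact ENNReal.ofReal_le_ofReal (le_ciSup (Set.finite_range x).bddAbove i)

theorem ENNReal.three_fourths_pow_le {q : ℕ} (hq : q ≠ 0) :
    (3 / 4 : ℝ≥0∞) ^ q ≤ 3 * (q : ℝ≥0∞)⁻¹ := by
  have hnat : ∀ q : ℕ, q * 3 ^ q ≤ 3 * 4 ^ q := by
    intro q
    induction q with
    | zero => simp
    | succ q ih =>
      have : 3 ^ q ≤ 4 ^ q := Nat.pow_le_pow_left (by norm_num) q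
      calc (q + 1) * 3 ^ (q + 1) = 3 * (q * 3 ^ q) + 3 * 3 ^ q := by ring
        _ ≤ 3 * (3 * 4 ^ q) + 3 * 4 ^ q := by gcongr
        _ = 3 * 4 ^ (q + 1) := by ring
  rw [← div_eq_mul_inv, ENNReal.le_div_iff_mul_le (by simp [hq]) (by simp)]
  have h4 : (4 : ℝ≥0∞) ^ q ≠ 0 := by positivity
  have h4' : (4 : ℝ≥0∞) ^ q ≠ ⊤ := ENNReal.pow_ne_top (by norm_num)
  refine (ENNReal.mul_le_mul_iff_left h4 h4').1 ?_
  calc (3 / 4 : ℝ≥0∞) ^ q * q * 4 ^ q = q * (3 / 4 * 4) ^ q := by rw [mul_pow]; ring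
    _ = q * 3 ^ q := by rw [ENNReal.div_mul_cancel (by norm_num) (by norm_num)]
    _ ≤ 3 * 4 ^ q := by exact_mod_cast hnat q

theorem ENNReal.ofReal_one_sub_mul_le {a b : ℝ≥0∞} {ε : ℝ} (hε : 0 ≤ ε) (ha : a ≠ ⊤)
    (h : a ≤ b + ENNReal.ofReal ε * a) : ENNReal.ofReal (1 - ε) * a ≤ b := by
  rw [ENNReal.ofReal_sub _ hε, ENNReal.ofReal_one, ENNReal.sub_mul fun _ _ => ha, one_mul]
  exact tsub_le_iff_right.2 h

theorem Nat.sqrt_sqrt_pow_four_le (n : ℕ) : n.sqrt.sqrt ^ 4 ≤ n := by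
  calc n.sqrt.sqrt ^ 4 = (n.sqrt.sqrt ^ 2) ^ 2 := by ring
    _ ≤ n.sqrt ^ 2 := Nat.pow_le_pow_left (Nat.sqrt_le' _) 2
    _ ≤ n := Nat.sqrt_le' n

theorem Nat.lt_succ_sqrt_sqrt_pow_four (n : ℕ) : n < (n.sqrt.sqrt + 1) ^ 4 := by
  have h1 : n.sqrt + 1 ≤ (n.sqrt.sqrt + 1) ^ 2 := Nat.lt_succ_sqrt' _
  calc n < (n.sqrt + 1) ^ 2 := Nat.lt_succ_sqrt' n
    _ ≤ ((n.sqrt.sqrt + 1) ^ 2) ^ 2 := Nat.pow_le_pow_left h1 2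
    _ = _ := by ring

/-- The factor 2 comes from `q + 1 ≤ 2 * q`. -/
theorem inv_le_two_mul_rpow {n q : ℕ} (hn : 0 < n) (hq : 1 ≤ q) (h : n < (q + 1) ^ 4) :
    (q : ℝ)⁻¹ ≤ 2 * (n : ℝ) ^ (-(1 / 4) : ℝ) := by
  have hq' : (1 : ℝ) ≤ q := by exact_mod_cast hq
  have hle : (n : ℝ) ^ (1 / 4 : ℝ) ≤ 2 * q := by
    have h1 : (n : ℝ) ≤ (2 * (q : ℝ)) ^ (4 : ℕ) := by
      have : (n : ℝ) ≤ ((q : ℝ) + 1) ^ 4 := by exact_mod_cast h.le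
      refine this.trans ?_
      gcongr
      linarith
    calc (n : ℝ) ^ (1 / 4 : ℝ) ≤ ((2 * (q : ℝ)) ^ (4 : ℕ)) ^ (1 / 4 : ℝ) := by gcongr
      _ = 2 * q := by
        have := Real.pow_rpow_inv_natCast (x := 2 * (q : ℝ)) (by positivity) (n := 4) (by norm_num)
        simpa using this
  have hpos : 0 < (n : ℝ) ^ (1 / 4 : ℝ) := by positivity
  rw [Real.rpow_neg (by positivity), ← div_eq_mul_inv, inv_eq_one_div,
    div_le_div_iff₀ (by positivity) hpos]
  linarith

/-! ### The strategy and its guarantees -/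

/-- The set of variables that are queried at all. -/
noncomputable def keptVariables {n : ℕ} (q : ℕ) (P : Measure (Fin n → ℝ)) : Finset (Fin n) :=
  Classical.epsilon fun S => S.Nonempty ∧ S.card + q ^ 3 ≤ n ∧
    ∫⁻ x, maxOver Finset.univ x ∂P ≤
      (q : ℝ≥0∞)⁻¹ * ∫⁻ x, maxOver Finset.univ x ∂P + ∫⁻ x, maxOver S x ∂P

theorem keptVariables_spec {n : ℕ} (h : 2 ≤ n.sqrt.sqrt) (P : Measure (Fin n → ℝ)) :
    (keptVariables n.sqrt.sqrt P).Nonempty ∧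
      (keptVariables n.sqrt.sqrt P).card + n.sqrt.sqrt ^ 3 ≤ n ∧
      ∫⁻ x, maxOver Finset.univ x ∂P ≤
        (n.sqrt.sqrt : ℝ≥0∞)⁻¹ * ∫⁻ x, maxOver Finset.univ x ∂P +
          ∫⁻ x, maxOver (keptVariables n.sqrt.sqrt P) x ∂P :=
  Classical.epsilon_spec (exists_cheap_to_drop h (Nat.sqrt_sqrt_pow_four_le n) P)

/-- Drop the cheapest `q ^ 3` variables, where `q` is about `n ^ (1 / 4)`, and sweep the others. -/
noncomputable def gamblerTree {n : ℕ} [NeZero n] (P : Measure (Fin n → ℝ)) : QueryTree n :=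
  -- This is `n < 16`. Asking nothing keeps the load at zero, as needed at `n = 1` where `log*` is
  -- zero; the reward bound is vacuous because `16 * n ^ (-1/4) > 1`.
  if n.sqrt.sqrt < 2 then .select 0
  else sweep n.sqrt.sqrt (keptVariables n.sqrt.sqrt P) P

section gamblerTree

variable {n : ℕ} [NeZero n] {P : Measure (Fin n → ℝ)}

theorem numQueries_gamblerTree_le (P : Measure (Fin n → ℝ)) (x : Fin n → ℝ) :
    (gamblerTree P).numQueries x ≤ n := by
  unfold gamblerTree
  split_ifs with h
  · simp
  · exact (numQueries_sweep_le _ _ _ _).trans (keptVariables_spec (not_lt.1 h) P).2.1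

theorem lintegral_load_gamblerTree_le [IsProbabilityMeasure P] (hP : IsProductLaw P) :
    ∫⁻ x, ((gamblerTree P).load x : ℝ≥0∞) ∂P ≤ ENNReal.ofReal (16 * (logStar (n : ℝ) : ℝ)) := by
  unfold gamblerTree
  split_ifs with h
  · simp
  · refine (lintegral_load_sweep_le hP).trans ?_
    have hn : 1 < n := by
      by_contra hn
      have h1 : n ≤ 1 := not_lt.1 hn
      have := Nat.sqrt_le_sqrt (Nat.sqrt_le_sqrt h1)
      simp at this
      omega
    have h1 : (1 : ℝ) ≤ logStar (n : ℝ) := by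
      exact_mod_cast one_le_logStar (x := n) (by exact_mod_cast hn)
    rw [← ENNReal.ofReal_ofNat]
    exact ENNReal.ofReal_le_ofReal (by linarith)

/-- The 8 collects `1/q` from dropping, `4/q` from the sweep, and `3/q` bounding `(3/4) ^ q`. -/
theorem lintegral_maxOver_le_gamblerTree [IsProbabilityMeasure P] (hP : IsProductLaw P)
    (h : 2 ≤ n.sqrt.sqrt) :
    ∫⁻ x, maxOver Finset.univ x ∂P ≤ ∫⁻ x, ENNReal.ofReal (x ((gamblerTree P).choice x)) ∂P +
      8 * (n.sqrt.sqrt : ℝ≥0∞)⁻¹ * ∫⁻ x, maxOver Finset.univ x ∂P := by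
  obtain ⟨hS, -, hdrop⟩ := keptVariables_spec h P
  rw [gamblerTree, if_neg h.not_gt]
  set q := n.sqrt.sqrt
  set S := keptVariables q P
  set M := ∫⁻ x, maxOver Finset.univ x ∂P
  set R := ∫⁻ x, ENNReal.ofReal (x ((sweep q S P).choice x)) ∂P
  have hSM : ∫⁻ x, maxOver S x ∂P ≤ M :=
    lintegral_mono fun x => maxOver_mono (Finset.subset_univ S) x
  calc M ≤ (q : ℝ≥0∞)⁻¹ * M + ∫⁻ x, maxOver S x ∂P := hdrop
    _ ≤ (q : ℝ≥0∞)⁻¹ * M + (R + (4 * (q : ℝ≥0∞)⁻¹ + (3 / 4) ^ q) * ∫⁻ x, maxOver S x ∂P) := by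
      gcongr
      exact lintegral_maxOver_le_sweep h hS hP
    _ ≤ (q : ℝ≥0∞)⁻¹ * M + (R + (4 * (q : ℝ≥0∞)⁻¹ + 3 * (q : ℝ≥0∞)⁻¹) * M) := by
      gcongr
      exact ENNReal.three_fourths_pow_le (by omega)
    _ = _ := by ring

theorem prophetValue_le_reward_gamblerTree [IsProbabilityMeasure P] (hP : IsProductLaw P)
    (hfin : ∫⁻ x, maxOver Finset.univ x ∂P ≠ ⊤) :
    ENNReal.ofReal (1 - 16 * (n : ℝ) ^ (-(1 / 4) : ℝ)) * ∫⁻ x, maxOver Finset.univ x ∂P ≤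
      ∫⁻ x, ENNReal.ofReal (x ((gamblerTree P).choice x)) ∂P := by
  have hn : 0 < n := Nat.pos_of_ne_zero (NeZero.ne n)
  have hq1 : 1 ≤ n.sqrt.sqrt := Nat.sqrt_pos.2 (Nat.sqrt_pos.2 hn)
  have hrate := inv_le_two_mul_rpow hn hq1 (Nat.lt_succ_sqrt_sqrt_pow_four n)
  rcases lt_or_ge n.sqrt.sqrt 2 with h | h
  · have hq : n.sqrt.sqrt = 1 := by omega
    rw [hq] at hrate
    norm_num at hrate
    -- With `q = 1`, `hrate` makes the competitive factor nonpositive.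
    rw [ENNReal.ofReal_of_nonpos (by norm_num; linarith), zero_mul]
    exact zero_le
  · have hbound : 8 * (n.sqrt.sqrt : ℝ≥0∞)⁻¹ ≤
        ENNReal.ofReal (16 * (n : ℝ) ^ (-(1 / 4) : ℝ)) := by
      have hq0 : (0 : ℝ) < n.sqrt.sqrt := by exact_mod_cast hq1
      have e : 8 * (n.sqrt.sqrt : ℝ≥0∞)⁻¹ = ENNReal.ofReal (8 * (n.sqrt.sqrt : ℝ)⁻¹) := by
        rw [ENNReal.ofReal_mul (by norm_num), ENNReal.ofReal_inv_of_pos hq0,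
          ENNReal.ofReal_natCast, ENNReal.ofReal_ofNat]
      rw [e]
      exact ENNReal.ofReal_le_ofReal (by linarith)
    refine ENNReal.ofReal_one_sub_mul_le (by positivity) hfin ?_
    refine (lintegral_maxOver_le_gamblerTree hP h).trans ?_
    gcongr

end gamblerTree

theorem exists_lintegral_eq_top {n : ℕ} {P : Measure (Fin n → ℝ)}
    (h : ∫⁻ x, maxOver Finset.univ x ∂P = ⊤) : ∃ i, ∫⁻ x, ENNReal.ofReal (x i) ∂P = ⊤ := by
  by_contra! hne
  have hle : ∫⁻ x, maxOver Finset.univ x ∂P ≤ ∑ i, ∫⁻ x, ENNReal.ofReal (x i) ∂P := by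
    rw [← lintegral_finsetSum _ fun i _ => (measurable_pi_apply i).ennreal_ofReal]
    refine lintegral_mono fun x => Finset.sup_le fun i hi => ?_
    exact Finset.single_le_sum (f := fun i => ENNReal.ofReal (x i)) (fun _ _ => zero_le) hi
  rw [h, top_le_iff, ENNReal.sum_eq_top] at hle
  obtain ⟨i, -, hi⟩ := hle
  exact hne i hi

namespace RandomizedStrategy

variable {n : ℕ} (T : QueryTree n) (P : Measure (Fin n → ℝ))

theorem expectedReward_pure : expectedReward (PMF.pure T) P =
    ∫⁻ x, ENNReal.ofReal (x (T.choice x)) ∂P := by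
  rw [expectedReward, tsum_eq_single T fun T' h => by simp [PMF.pure_apply, h]]
  simp

theorem expectedLoad_pure : expectedLoad (PMF.pure T) P = ∫⁻ x, (T.load x : ℝ≥0∞) ∂P := by
  rw [expectedLoad, tsum_eq_single T fun T' h => by simp [PMF.pure_apply, h]]
  simp

end RandomizedStrategy

theorem theorem5 :
    ∃ A : (n : ℕ) → [NeZero n] → (Fin n → Measure ℝ) → RandomizedStrategy n,
    ∃ C c : ℝ, 0 < C ∧ 0 < c ∧
      ∀ (n : ℕ) [NeZero n] (μ : Fin n → Measure ℝ),
        (∀ i, IsProbabilityMeasure (μ i)) →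
        (∀ i (a : ℝ), μ i {a} = 0) →
        (∀ i, μ i (Set.Iio 0) = 0) →
          (A n μ).IsAdmissible (Measure.pi μ) ∧
          (A n μ).expectedLoad (Measure.pi μ) ≤ ENNReal.ofReal (C * (logStar (n : ℝ) : ℝ)) ∧
          ENNReal.ofReal (1 - C * (n : ℝ) ^ (-c)) * prophetValue (Measure.pi μ) ≤
            (A n μ).expectedReward (Measure.pi μ) := by
  -- No randomness is needed. The constant 16 is 8 from the loss times 2 from `1/q ≤ 2 * n ^
  -- (-1/4)`, and it also exceeds the load bound 5.
  refine ⟨fun n _ μ => PMF.pure ((gamblerTree (Measure.pi μ)).optimize (Measure.pi μ) Set.univ),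
    16, 1 / 4, by norm_num, by norm_num, fun n _ μ hμ hμ' _ => ?_⟩
  have hP : IsProductLaw (Measure.pi μ) := ⟨μ, fun i => inferInstance, hμ', rfl⟩
  refine ⟨fun T hT => ?_, ?_, ?_⟩
  · rw [PMF.support_pure, Set.mem_singleton_iff] at hT
    subst hT
    refine ⟨fun x => ?_, QueryTree.selectsBest_optimize _ _⟩
    rw [QueryTree.numQueries_optimize]
    exact numQueries_gamblerTree_le _ x
  · rw [RandomizedStrategy.expectedLoad_pure]
    simp only [QueryTree.load_optimize]
    exact lintegral_load_gamblerTree_le hP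
  · rw [RandomizedStrategy.expectedReward_pure, prophetValue_eq_lintegral_maxOver]
    -- The loss estimate says nothing when the prophet value is infinite. Then some single variable
    -- has infinite expectation, and optimal selection does at least as well.
    by_cases hfin : ∫⁻ x, maxOver Finset.univ x ∂Measure.pi μ = ⊤
    · obtain ⟨i, hi⟩ := exists_lintegral_eq_top hfin
      have h := QueryTree.lintegral_le_optimize (Measure.pi μ) (gamblerTree (Measure.pi μ))
        Set.univ MeasurableSet.univ i
      rw [setLIntegral_univ, setLIntegral_univ, hi, top_le_iff] at h
      rw [h]
      exact le_top
    · refine (prophetValue_le_reward_gamblerTree hP hfin).trans ?_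
      simpa using QueryTree.lintegral_choice_le_optimize (Measure.pi μ)
        (gamblerTree (Measure.pi μ)) Set.univ MeasurableSet.univ
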